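/- A \emph{map} $M$ is given by a finite set $C$ of crosses with three fixed-point-free involutions $\alpha_0,\alpha_1,\alpha_2$ such that $\alpha_0\alpha_2=\alpha_2\alpha_0$ is also fixed-point-free, together with finitely many isolated vertices. Its vertices are the orbits of $\langle\alpha_1,\alpha_2\rangle$ and the isolated vertices, its edges are the orbits of $\langle\alpha_0,\alpha_2\rangle$, its faces are the orbits of $\langle\alpha_0,\alpha_1\rangle$ and one face for each isolated vertex, and its connected components are the orbits of $\langle\alpha_0,\alpha_1,\alpha_2\rangle$ and the isolated vertices. The map is orientable if every component other than an isolated vertex splits into two orbits of $\langle\alpha_0\alpha_2,\alpha_1\alpha_2\rangle$. With $v,e,f,k$ the numbers of vertices, edges, faces and components, the Euler genus is $2k-(v-e+f)$, and the signed genus is half the Euler genus if $M$ is orientable and minus the Euler genus otherwise. A map is \emph{plane} if its signed genus is $0$. The underlying graph of $M$ consists of its vertices and edges with the obvious incidence. A submap of $M$ is obtained by deleting edges (removing their crosses from the cycles of $\alpha_1\alpha_2$) and then isolated vertices. A \emph{vertex gluing} identifies two distinct vertices $u,v$: one chooses crosses $a$ at $u$ and $b$ at $v$ that lie in the same cycle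 of $\alpha_1\alpha_0$ or in different components, and replaces the transpositions $(a\ \alpha_1a)(b\ \alpha_1b)$ of $\alpha_1$ by $(a\ \alpha_1b)(b\ \alpha_1a)$; if $u$ or $v$ is isolated, gluing deletes an isolated one of the two. A \emph{duplicate edge gluing} merges two distinct edges that bound a common face of degree two. An \emph{epimorphism} from $M$ onto $N$ (maps of the same signed genus) is an isomorphism of $N$ to a map obtained from $M$ by a sequence of vertex gluings followed by a sequence of duplicate edge gluings. A \emph{homomorphism} $M\to M'$ (maps of the same signed genus) is an epimorphism from $M$ onto a submap of $M'$ followed by the inclusion. A \emph{map core} is a map that has no homomorphism to a proper submap of itself; a \emph{graph core} is a graph that has no graph homomorphism to a proper subgraph of itself. The \emph{odd girth} of a graph is the length of its shortest odd cycle. \textbf{Theorem.} For every even $n\ge 0$ and every odd $k\ge 3$ there exist connected plane maps $B$ and $A_1,\dots,A_n$ such that \begin{itemize} \item the underlying graphs of $A_1,\dots,A_n$ are graph cores, and $A_1,\dots,A_n$ and $B$ are map cores; \item the underlying graphs of $B$ and of $A_1,\dots,A_n$ all have odd girth $2k+1$; \item for each $i$ there is a homomorphism $A_i\to B$, and in fact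 an epimorphism from $A_i$ onto $B$; \item for distinct $i,j$ there is no homomorphism from $A_i$ to $A_j$. \end{itemize} In particular there are arbitrarily large antichains of map cores with a common homomorphic image. -/

import Mathlib

/-- A combinatorial map (graph cellularly embedded in closed surfaces, one surface for each connected
component): a finite set `C` of crosses with three fixed-point-free involutions `a0`, `a1`, `a2`,
the first and the last of which commute, and a finite set `V` of vertices.  The crosses at a vertex
form one orbit of the group generated by `a1` and `a2`, that is, a pair of cycles of the vertex
permutation `a1 ∘ a2`; a vertex without crosses is isolated.  The condition `a0_a2_ne` says that
every edge consists of four distinct crosses `c, a0 c, a2 c, a0 (a2 c)`. -/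
structure CMap where
  /-- vertices -/
  V : Type
  /-- crosses -/
  C : Type
  finV : Finite V
  finC : Finite C
  a0 : C → C
  a1 : C → C
  a2 : C → C
  a0_a0 : ∀ c, a0 (a0 c) = c
  a1_a1 : ∀ c, a1 (a1 c) = c
  a2_a2 : ∀ c, a2 (a2 c) = c
  a0_ne : ∀ c, a0 c ≠ c
  a1_ne : ∀ c, a1 c ≠ c
  a2_ne : ∀ c, a2 c ≠ c
  a0_a2_comm : ∀ c, a0 (a2 c) = a2 (a0 c)
  a0_a2_ne : ∀ c, a0 (a2 c) ≠ c
  /-- the vertex that a cross is incident with -/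
  vert : C → V
  vert_eq_iff : ∀ c d, vert c = vert d ↔ Relation.EqvGen (fun x y => y = a1 x ∨ y = a2 x) c d

namespace CMap

/-- The vertex permutation `τ`. -/
def tau (M : CMap) (c : M.C) : M.C := M.a1 (M.a2 c)

/-- The face permutation `φ`. -/
def phi (M : CMap) (c : M.C) : M.C := M.a1 (M.a0 c)

/-- Crosses modulo the group generated by `a0` and `a2`. -/
def edgeSetoid (M : CMap) : Setoid M.C :=
  Relation.EqvGen.setoid (fun x y => y = M.a0 x ∨ y = M.a2 x)

/-- Crosses modulo the group generated by `a0` and `a1`. -/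
def faceSetoid (M : CMap) : Setoid M.C :=
  Relation.EqvGen.setoid (fun x y => y = M.a0 x ∨ y = M.a1 x)

/-- Crosses modulo the group generated by `a0`, `a1` and `a2`. -/
def compSetoid (M : CMap) : Setoid M.C :=
  Relation.EqvGen.setoid (fun x y => y = M.a0 x ∨ y = M.a1 x ∨ y = M.a2 x)

/-- Crosses modulo the group generated by `a0 a2` and `a1 a2`. -/
def orientSetoid (M : CMap) : Setoid M.C :=
  Relation.EqvGen.setoid (fun x y => y = M.a0 (M.a2 x) ∨ y = M.a1 (M.a2 x))

/-- The edges of a map. -/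
def Edge (M : CMap) : Type := Quotient M.edgeSetoid

/-- The edge that a cross belongs to. -/
def edge (M : CMap) (c : M.C) : M.Edge := Quotient.mk M.edgeSetoid c

/-- A vertex without incident crosses. -/
def IsIsolated (M : CMap) (v : M.V) : Prop := ∀ c, M.vert c ≠ v

/-- The number of isolated vertices; each of them is a connected component with a single face. -/
noncomputable def numIsolated (M : CMap) : ℕ := Nat.card {v : M.V // M.IsIsolated v}

noncomputable def numVertices (M : CMap) : ℕ := Nat.card M.V

noncomputable def numEdges (M : CMap) : ℕ := Nat.card M.Edge

noncomputable def numFaces (M : CMap) : ℕ := Nat.card (Quotient M.faceSetoid) + M.numIsolated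

noncomputable def numComponents (M : CMap) : ℕ := Nat.card (Quotient M.compSetoid) + M.numIsolated

/-- A map is connected if it has exactly one connected component. -/
def IsConnected (M : CMap) : Prop := M.numComponents = 1

/-- A component is orientable if it splits into two orbits of the group generated by `a0 a2` and
`a1 a2`; these are then exchanged by `a2`.  If there is one orbit only, it contains `c` and `a2 c`.
A map is orientable if all its components are (isolated vertices lie on spheres). -/
def IsOrientable (M : CMap) : Prop := ∀ c, ¬ M.orientSetoid c (M.a2 c)

/-- The Euler genus `2k - (v - e + f)`. -/
noncomputable def eulerGenus (M : CMap) : ℤ :=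
  2 * (M.numComponents : ℤ) - ((M.numVertices : ℤ) - (M.numEdges : ℤ) + (M.numFaces : ℤ))

open Classical in
/-- The signed genus: half the Euler genus for orientable maps, minus the Euler genus for
non-orientable ones. -/
noncomputable def signedGenus (M : CMap) : ℚ :=
  if M.IsOrientable then (M.eulerGenus : ℚ) / 2 else -(M.eulerGenus : ℚ)

/-- A plane map is a map of signed genus zero. -/
def IsPlane (M : CMap) : Prop := M.signedGenus = 0

/-! ### The underlying graph -/

theorem edgeSetoid_cases (M : CMap) {c d : M.C} (h : M.edgeSetoid c d) :
    d = c ∨ d = M.a0 c ∨ d = M.a2 c ∨ d = M.a0 (M.a2 c) := by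
  have h' : Relation.EqvGen (fun x y => y = M.a0 x ∨ y = M.a2 x) c d := h
  clear h
  induction h' with
  | rel x y h =>
    rcases h with h | h
    · exact Or.inr (Or.inl h)
    · exact Or.inr (Or.inr (Or.inl h))
  | refl x => exact Or.inl rfl
  | symm x y hxy ih =>
    rcases ih with h | h | h | h
    · exact Or.inl h.symm
    · exact Or.inr (Or.inl (by rw [h, M.a0_a0]))
    · exact Or.inr (Or.inr (Or.inl (by rw [h, M.a2_a2])))
    · exact Or.inr (Or.inr (Or.inr (by rw [h, ← M.a0_a2_comm, M.a0_a0, M.a2_a2])))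
  | trans x y z hxy hyz ih1 ih2 =>
    have e0 := M.a0_a0
    have e2 := M.a2_a2
    have e := M.a0_a2_comm
    rcases ih1 with h | h | h | h <;> rcases ih2 with h' | h' | h' | h' <;>
      subst h <;> subst h' <;> simp [e, e0, e2]

theorem vert_a2 (M : CMap) (c : M.C) : M.vert (M.a2 c) = M.vert c :=
  ((M.vert_eq_iff c (M.a2 c)).2 (Relation.EqvGen.rel _ _ (Or.inr rfl))).symm

theorem vert_a1 (M : CMap) (c : M.C) : M.vert (M.a1 c) = M.vert c :=
  ((M.vert_eq_iff c (M.a1 c)).2 (Relation.EqvGen.rel _ _ (Or.inl rfl))).symm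

/-- The underlying graph (loops and parallel edges are allowed): the edge of a cross `c` joins the
vertex of `c` to the vertex of `a0 c`. -/
def graph (M : CMap) : Graph M.V M.Edge where
  vertexSet := Set.univ
  IsLink e x y := ∃ c, M.edge c = e ∧ M.vert c = x ∧ M.vert (M.a0 c) = y
  isLink_symm := by
    rintro e -
    constructor
    rintro x y ⟨c, rfl, rfl, rfl⟩
    refine ⟨M.a0 c, ?_, rfl, by rw [M.a0_a0]⟩
    exact (Quotient.sound (s := M.edgeSetoid) (Relation.EqvGen.rel _ _ (Or.inl rfl))).symm
  eq_or_eq_of_isLink_of_isLink := by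
    rintro e x y v w ⟨c, hc, rfl, rfl⟩ ⟨d, hd, rfl, rfl⟩
    have h : M.edgeSetoid c d := Quotient.exact (hc.trans hd.symm)
    have h2 := M.vert_a2
    rcases M.edgeSetoid_cases h with h | h | h | h <;> subst h
    · exact Or.inl rfl
    · exact Or.inr (by rw [M.a0_a0])
    · exact Or.inl (h2 c).symm
    · exact Or.inr (by rw [M.a0_a0, h2])
  left_mem_of_isLink := by
    intros
    trivial

/-! ### Submaps -/

/-- The data of a submap: a set of vertices and a set of edges (given by their crosses) all of whose
ends are among these vertices. -/
@[ext]
structure Submap (M : CMap) where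
  verts : Set M.V
  crosses : Set M.C
  a0_mem : ∀ c ∈ crosses, M.a0 c ∈ crosses
  a2_mem : ∀ c ∈ crosses, M.a2 c ∈ crosses
  vert_mem : ∀ c ∈ crosses, M.vert c ∈ verts

theorem tau_injective (M : CMap) : Function.Injective M.tau := by
  intro c d h
  have h1 : M.a2 c = M.a2 d := by
    rw [← M.a1_a1 (M.a2 c), ← M.a1_a1 (M.a2 d)]
    exact congrArg M.a1 h
  rw [← M.a2_a2 c, ← M.a2_a2 d, h1]

theorem exists_tau_iterate_eq (M : CMap) (c : M.C) : ∃ p, M.tau^[p + 1] c = c := by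
  have := M.finC
  obtain ⟨n, hn, h⟩ := (M.tau_injective).mem_periodicPts c
  exact ⟨n - 1, by rw [Nat.sub_add_cancel hn]; exact h⟩

theorem tau_iterate_a2_ne (M : CMap) (m : ℕ) (c : M.C) : M.tau^[m] (M.a2 c) ≠ c := by
  induction m using Nat.strong_induction_on generalizing c with
  | _ m ih =>
    match m, ih with
    | 0, _ => exact M.a2_ne c
    | 1, _ =>
      show M.a1 (M.a2 (M.a2 c)) ≠ c
      rw [M.a2_a2]
      exact M.a1_ne c
    | m + 2, ih =>
      intro h
      have h1 : M.tau (M.a2 c) = M.a2 (M.a2 (M.a1 c)) := by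
        show M.a1 (M.a2 (M.a2 c)) = _
        rw [M.a2_a2, M.a2_a2]
      apply ih m (by omega) (M.a2 (M.a1 c))
      apply M.tau_injective
      have h2 : M.tau^[m + 2] (M.a2 c) = M.tau (M.tau^[m] (M.tau (M.a2 c))) := by
        rw [← Function.iterate_succ_apply, ← Function.iterate_succ_apply' (f := M.tau)]
      rw [← h1, ← h2, h]
      show c = M.a1 (M.a2 (M.a2 (M.a1 c)))
      rw [M.a2_a2, M.a1_a1]

namespace Submap

variable {M : CMap} (N : Submap M)

theorem exists_return (c : M.C) (hc : c ∈ N.crosses) :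
    ∃ n, M.tau^[n] (M.a1 c) ∈ N.crosses := by
  obtain ⟨p, hp⟩ := M.exists_tau_iterate_eq (M.a2 c)
  refine ⟨p, ?_⟩
  rw [Function.iterate_succ_apply] at hp
  have h : M.tau (M.a2 c) = M.a1 c := by
    show M.a1 (M.a2 (M.a2 c)) = _
    rw [M.a2_a2]
  rw [← h, hp]
  exact N.a2_mem c hc

open Classical in
/-- The number of deleted crosses that are skipped after `c`. -/
noncomputable def skip (c : N.crosses) : ℕ := Nat.find (N.exists_return c.1 c.2)

/-- The involution `a1` of a submap: the crosses of the deleted edges are removed from the cycles of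
the vertex permutation, so starting from `a1 c` one follows the vertex permutation of the whole map
up to the first cross of the submap. -/
noncomputable def a1 (c : N.crosses) : N.crosses :=
  ⟨M.tau^[N.skip c] (M.a1 c), by
    classical
    exact Nat.find_spec (N.exists_return c.1 c.2)⟩

theorem skip_le (c : N.crosses) {n : ℕ} (h : M.tau^[n] (M.a1 c) ∈ N.crosses) : N.skip c ≤ n := by
  classical
  exact Nat.find_min' _ h

theorem mem_of_a2_mem {c : M.C} (h : M.a2 c ∈ N.crosses) : c ∈ N.crosses := by
  have := N.a2_mem _ h
  rwa [M.a2_a2] at this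

theorem tau_a2_tau (c : M.C) : M.tau (M.a2 (M.tau c)) = M.a2 c := by
  show M.a1 (M.a2 (M.a2 (M.a1 (M.a2 c)))) = _
  rw [M.a2_a2, M.a1_a1]

theorem tau_iterate_a2 (n m : ℕ) (c : M.C) :
    M.tau^[n] (M.a2 (M.tau^[n + m] c)) = M.a2 (M.tau^[m] c) := by
  induction n with
  | zero => simp
  | succ n ih =>
    rw [Function.iterate_succ_apply, show n + 1 + m = (n + m) + 1 by omega,
      Function.iterate_succ_apply', tau_a2_tau, ih]

theorem a1_a1 (c : N.crosses) : N.a1 (N.a1 c) = c := by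
  obtain ⟨c, hc⟩ := c
  set n := N.skip ⟨c, hc⟩ with hn
  have h1 : M.a1 c = M.tau (M.a2 c) := by
    show _ = M.a1 (M.a2 (M.a2 c))
    rw [M.a2_a2]
  have key : ∀ m ≤ n, M.tau^[m] (M.a1 (N.a1 ⟨c, hc⟩ : N.crosses)) =
      M.a2 (M.tau^[n - m] (M.a2 c)) := by
    intro m hm
    have h2 : M.a1 (N.a1 ⟨c, hc⟩ : N.crosses) = M.a2 (M.tau^[n] (M.a2 c)) := by
      show M.a1 (M.tau^[n] (M.a1 c)) = _
      rw [h1, ← Function.iterate_succ_apply, Function.iterate_succ_apply']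
      show M.a1 (M.a1 _) = _
      rw [M.a1_a1]
    rw [h2]
    have := tau_iterate_a2 m (n - m) (M.a2 c)
    rwa [show m + (n - m) = n by omega] at this
  have hret : M.tau^[n] (M.a1 (N.a1 ⟨c, hc⟩ : N.crosses)) = c := by
    rw [key n le_rfl]
    simp [M.a2_a2]
  have hskip : N.skip (N.a1 ⟨c, hc⟩) = n := by
    refine le_antisymm (N.skip_le _ (by rw [hret]; exact hc)) ?_
    by_contra hlt
    push Not at hlt
    have h3 := (N.a1 (N.a1 ⟨c, hc⟩)).2
    have h4 : ((N.a1 (N.a1 ⟨c, hc⟩) : N.crosses) : M.C) =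
        M.a2 (M.tau^[n - N.skip (N.a1 ⟨c, hc⟩)] (M.a2 c)) := key _ hlt.le
    rw [h4] at h3
    have h5 := N.mem_of_a2_mem h3
    obtain ⟨r, hr⟩ : ∃ r, n - N.skip (N.a1 ⟨c, hc⟩) = r + 1 := ⟨_, (Nat.succ_pred_eq_of_pos (by omega)).symm⟩
    rw [hr, Function.iterate_succ_apply, ← h1] at h5
    have := N.skip_le ⟨c, hc⟩ h5
    omega
  apply Subtype.ext
  show M.tau^[N.skip (N.a1 ⟨c, hc⟩)] _ = c
  rw [hskip, hret]

theorem a1_ne (c : N.crosses) : N.a1 c ≠ c := by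
  intro h
  have h1 : M.tau^[N.skip c] (M.a1 c) = c := congrArg Subtype.val h
  have h2 : M.a1 c = M.tau (M.a2 c) := by
    show _ = M.a1 (M.a2 (M.a2 c))
    rw [M.a2_a2]
  rw [h2, ← Function.iterate_succ_apply] at h1
  exact M.tau_iterate_a2_ne _ _ h1

/-- The relation that generates the vertices of the submap. -/
abbrev vertRel (x y : N.crosses) : Prop := y = N.a1 x ∨ y = ⟨M.a2 x, N.a2_mem x x.2⟩

theorem vert_tau_iterate (n : ℕ) (c : M.C) : M.vert (M.tau^[n] c) = M.vert c := by
  induction n with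
  | zero => rfl
  | succ n ih =>
    rw [Function.iterate_succ_apply']
    show M.vert (M.a1 (M.a2 _)) = _
    rw [M.vert_a1, M.vert_a2, ih]

theorem eqvGen_tau (i : ℕ) : ∀ (c : M.C) (hc : c ∈ N.crosses) (h : M.tau^[i] c ∈ N.crosses),
    Relation.EqvGen N.vertRel ⟨c, hc⟩ ⟨M.tau^[i] c, h⟩ := by
  induction i using Nat.strong_induction_on with
  | _ i ih =>
    intro c hc h
    rcases i with _ | i
    · exact Relation.EqvGen.refl _
    · have hle : N.skip ⟨M.a2 c, N.a2_mem c hc⟩ ≤ i := N.skip_le _ (by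
        rw [Function.iterate_succ_apply] at h
        exact h)
      have e : M.tau^[i + 1] c =
          M.tau^[i - N.skip ⟨M.a2 c, N.a2_mem c hc⟩] (N.a1 ⟨M.a2 c, N.a2_mem c hc⟩ : N.crosses) := by
        show _ = M.tau^[_] (M.tau^[_] (M.tau c))
        rw [← Function.iterate_add_apply, Function.iterate_succ_apply, Nat.sub_add_cancel hle]
      have h' : M.tau^[i - N.skip ⟨M.a2 c, N.a2_mem c hc⟩]
          (N.a1 ⟨M.a2 c, N.a2_mem c hc⟩ : N.crosses) ∈ N.crosses := by
        rw [← e]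
        exact h
      have h3 := ih _ (by omega) _ (N.a1 ⟨M.a2 c, N.a2_mem c hc⟩).2 h'
      have h4 : (⟨M.tau^[i + 1] c, h⟩ : N.crosses) = ⟨_, h'⟩ := Subtype.ext e
      rw [h4]
      refine Relation.EqvGen.trans _ _ _ (Relation.EqvGen.trans _ _ _
        (Relation.EqvGen.rel _ ⟨M.a2 c, N.a2_mem c hc⟩ (Or.inr rfl))
        (Relation.EqvGen.rel _ _ (Or.inl rfl))) h3

theorem orbit_cases {c d : M.C}
    (h : Relation.EqvGen (fun x y => y = M.a1 x ∨ y = M.a2 x) c d) :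
    ∃ i, d = M.tau^[i] c ∨ d = M.a2 (M.tau^[i] c) := by
  have key : ∀ x y, Relation.EqvGen (fun x y => y = M.a1 x ∨ y = M.a2 x) x y →
      ((∃ i, x = M.tau^[i] c ∨ x = M.a2 (M.tau^[i] c)) ↔
        (∃ i, y = M.tau^[i] c ∨ y = M.a2 (M.tau^[i] c))) := by
    have ha2 : ∀ x, (∃ i, x = M.tau^[i] c ∨ x = M.a2 (M.tau^[i] c)) →
        (∃ i, M.a2 x = M.tau^[i] c ∨ M.a2 x = M.a2 (M.tau^[i] c)) := by
      rintro x ⟨i, rfl | rfl⟩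
      · exact ⟨i, Or.inr rfl⟩
      · exact ⟨i, Or.inl (M.a2_a2 _)⟩
    have ha1 : ∀ x, (∃ i, x = M.tau^[i] c ∨ x = M.a2 (M.tau^[i] c)) →
        (∃ i, M.a1 x = M.tau^[i] c ∨ M.a1 x = M.a2 (M.tau^[i] c)) := by
      have hs : ∀ i, M.a1 (M.tau^[i + 1] c) = M.a2 (M.tau^[i] c) := by
        intro i
        rw [Function.iterate_succ_apply']
        exact M.a1_a1 _
      rintro x ⟨i, rfl | rfl⟩
      · rcases i with _ | i
        · obtain ⟨p, hp⟩ := M.exists_tau_iterate_eq c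
          refine ⟨p, Or.inr ?_⟩
          rw [← hs, hp]
          rfl
        · exact ⟨i, Or.inr (hs i)⟩
      · exact ⟨i + 1, Or.inl (by rw [Function.iterate_succ_apply']; rfl)⟩
    intro x y hxy
    induction hxy with
    | rel x y h =>
      rcases h with rfl | rfl
      · exact ⟨ha1 x, fun h => by simpa [M.a1_a1] using ha1 _ h⟩
      · exact ⟨ha2 x, fun h => by simpa [M.a2_a2] using ha2 _ h⟩
    | refl x => exact Iff.rfl
    | symm x y _ ih => exact ih.symm
    | trans x y z _ _ ih1 ih2 => exact ih1.trans ih2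
  exact (key c d h).1 ⟨0, Or.inl rfl⟩

theorem vert_eq_iff (c d : N.crosses) :
    M.vert c = M.vert d ↔ Relation.EqvGen N.vertRel c d := by
  constructor
  · intro h
    obtain ⟨i, h | h⟩ := orbit_cases ((M.vert_eq_iff c d).1 h)
    · have hm : M.tau^[i] (c : M.C) ∈ N.crosses := h ▸ d.2
      have e : d = ⟨_, hm⟩ := Subtype.ext h
      rw [e]
      exact N.eqvGen_tau i c c.2 hm
    · have hm : M.tau^[i] (c : M.C) ∈ N.crosses := N.mem_of_a2_mem (h ▸ d.2)
      have e : d = ⟨M.a2 (M.tau^[i] c), N.a2_mem _ hm⟩ := Subtype.ext h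
      rw [e]
      exact Relation.EqvGen.trans _ _ _ (N.eqvGen_tau i c c.2 hm)
        (Relation.EqvGen.rel _ _ (Or.inr rfl))
  · intro h
    induction h with
    | rel x y h =>
      rcases h with rfl | rfl
      · show _ = M.vert (M.tau^[_] (M.a1 _))
        rw [vert_tau_iterate, M.vert_a1]
      · exact (M.vert_a2 _).symm
    | refl x => rfl
    | symm x y _ ih => exact ih.symm
    | trans x y z _ _ ih1 ih2 => exact ih1.trans ih2

/-- The submap as a map: the map that is left after the deletion of all edges outside `crosses` and
of all vertices outside `verts`. -/
noncomputable def toMap : CMap where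
  V := N.verts
  C := N.crosses
  finV := haveI := M.finV; inferInstance
  finC := haveI := M.finC; inferInstance
  a0 c := ⟨M.a0 c, N.a0_mem c c.2⟩
  a1 := N.a1
  a2 c := ⟨M.a2 c, N.a2_mem c c.2⟩
  a0_a0 c := Subtype.ext (M.a0_a0 c)
  a1_a1 := N.a1_a1
  a2_a2 c := Subtype.ext (M.a2_a2 c)
  a0_ne c h := M.a0_ne c (congrArg Subtype.val h)
  a1_ne := N.a1_ne
  a2_ne c h := M.a2_ne c (congrArg Subtype.val h)
  a0_a2_comm c := Subtype.ext (M.a0_a2_comm c)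
  a0_a2_ne c h := M.a0_a2_ne c (congrArg Subtype.val h)
  vert c := ⟨M.vert c, N.vert_mem c c.2⟩
  vert_eq_iff c d := by
    rw [Subtype.mk.injEq]
    exact N.vert_eq_iff c d

/-- A submap is proper if it is not the whole map. -/
def IsProper : Prop := N.verts ≠ Set.univ ∨ N.crosses ≠ Set.univ

end Submap

/-! ### Homomorphisms -/

/-- Isomorphism of maps. -/
def Iso (M M' : CMap) : Prop :=
  ∃ (p : M.V ≃ M'.V) (j : M.C ≃ M'.C), (∀ c, M'.vert (j c) = p (M.vert c)) ∧
    (∀ c, M'.a0 (j c) = j (M.a0 c)) ∧ (∀ c, M'.a1 (j c) = j (M.a1 c)) ∧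
    (∀ c, M'.a2 (j c) = j (M.a2 c))

/-- Two crosses are coincident with a common face if they are in the same cycle of `φ`. -/
def FaceCoincident (M : CMap) (a b : M.C) : Prop := ∃ m : ℕ, M.phi^[m] a = b

/-- `M'` is, up to isomorphism, obtained from `M` by one vertex gluing.  The distinct vertices `u`
and `v` become one vertex and all other vertices are kept.  If `u` and `v` are not isolated, then the
gluing is given by riffling crosses `a` at `u` and `b` at `v` which are coincident with a common face
or belong to different connected components: the involutions `a0` and `a2` are kept, and `a1` is
replaced by the involution that sends `a` to `a1 b` and `b` to `a1 a` and agrees with `a1` outside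
`{a, b, a1 a, a1 b}`.  If `u` or `v` is isolated, then the gluing just removes an isolated
vertex. -/
def VertexGluing (M M' : CMap) : Prop :=
  ∃ (u v : M.V) (p : M.V → M'.V) (j : M.C ≃ M'.C),
    u ≠ v ∧ Function.Surjective p ∧
    (∀ x y, p x = p y ↔ x = y ∨ (x = u ∧ y = v) ∨ (x = v ∧ y = u)) ∧
    (∀ c, M'.vert (j c) = p (M.vert c)) ∧
    (∀ c, M'.a0 (j c) = j (M.a0 c)) ∧
    (∀ c, M'.a2 (j c) = j (M.a2 c)) ∧
    ((∃ a b : M.C, M.vert a = u ∧ M.vert b = v ∧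
        (M.FaceCoincident a b ∨ ¬ M.compSetoid a b) ∧
        M'.a1 (j a) = j (M.a1 b) ∧ M'.a1 (j b) = j (M.a1 a) ∧
        ∀ c, c ≠ a → c ≠ b → c ≠ M.a1 a → c ≠ M.a1 b → M'.a1 (j c) = j (M.a1 c)) ∨
      ((M.IsIsolated u ∨ M.IsIsolated v) ∧ ∀ c, M'.a1 (j c) = j (M.a1 c)))

/-- `M'` is, up to isomorphism, obtained from `M` by gluing two duplicate edges, that is, two
distinct edges with crosses `a` and `b` such that `(a b)` is a cycle of length two of the face
permutation.  The crosses `a, a0 a, b, a0 b` are removed, `a0` and `a1` are kept on the remaining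
crosses, and `a2` is changed so that it exchanges `a2 a` with `a0 (a2 b)` and `a0 (a2 a)` with
`a2 b`. -/
def DuplicateGluing (M M' : CMap) : Prop :=
  ∃ (a b : M.C) (p : M'.V ≃ M.V) (j : M'.C → M.C),
    M.phi a = b ∧ M.phi b = a ∧ M.edge a ≠ M.edge b ∧
    Function.Injective j ∧ Set.range j = {a, M.a0 a, b, M.a0 b}ᶜ ∧
    (∀ c, p (M'.vert c) = M.vert (j c)) ∧
    (∀ c, j (M'.a0 c) = M.a0 (j c)) ∧
    (∀ c, j (M'.a1 c) = M.a1 (j c)) ∧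
    (∀ c, j c = M.a2 a → j (M'.a2 c) = M.a0 (M.a2 b)) ∧
    (∀ c, j c = M.a0 (M.a2 a) → j (M'.a2 c) = M.a2 b) ∧
    (∀ c, j c ≠ M.a2 a → j c ≠ M.a0 (M.a2 a) → j c ≠ M.a2 b → j c ≠ M.a0 (M.a2 b) →
      j (M'.a2 c) = M.a2 (j c))

/-- There is an epimorphism from `M` onto `N`: the maps have the same signed genus, and `N` is
isomorphic to a map obtained from `M` by a sequence of vertex gluings followed by a sequence of
duplicate edge gluings. -/
def Epi (M N : CMap) : Prop :=
  M.signedGenus = N.signedGenus ∧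
    ∃ P Q : CMap, Relation.ReflTransGen VertexGluing M P ∧
      Relation.ReflTransGen DuplicateGluing P Q ∧ Iso Q N

/-- There is a map homomorphism from `M` to `M'`: the maps have the same signed genus, and there is
an epimorphism from `M` onto a submap of `M'`. -/
def Hom (M M' : CMap) : Prop :=
  M.signedGenus = M'.signedGenus ∧ ∃ N : Submap M', Epi M N.toMap

/-- A map core: a map without homomorphism to a proper submap of itself. -/
def IsCore (M : CMap) : Prop := ∀ N : Submap M, N.IsProper → ¬ Hom M N.toMap

end CMap

/-! ### Graph homomorphisms, graph cores and odd girth -/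

/-- There is a graph homomorphism from `G` to `H`: a map of vertices that sends the ends of every
edge of `G` to the ends of some edge of `H`. -/
def GraphHom {α β α' β' : Type} (G : Graph α β) (H : Graph α' β') : Prop :=
  ∃ f : α → α', (∀ x, x ∈ G.vertexSet → f x ∈ H.vertexSet) ∧
    ∀ e x y, G.IsLink e x y → ∃ e', H.IsLink e' (f x) (f y)

/-- A graph core: a graph without homomorphism to a proper subgraph of itself. -/
def IsGraphCore {α β : Type} (G : Graph α β) : Prop :=
  ∀ H : Graph α β, H ≤ G → H ≠ G → ¬ GraphHom G H

/-- The graph has a cycle with `l ≥ 1` vertices and `l` edges (a loop for `l = 1`). -/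
def HasCycle {α β : Type} (G : Graph α β) (l : ℕ) : Prop :=
  1 ≤ l ∧ ∃ (x : ZMod l → α) (e : ZMod l → β), Function.Injective x ∧ Function.Injective e ∧
    ∀ i, G.IsLink (e i) (x i) (x (i + 1))

/-- The shortest cycle of odd length has length `g`. -/
def HasOddGirth {α β : Type} (G : Graph α β) (g : ℕ) : Prop :=
  IsLeast {l : ℕ | Odd l ∧ HasCycle G l} g

/-!
All maps below are colourability-critical: a *colouring* is a graph homomorphism to the cycle of
length `N = 2 k + 1`, and a map is *critical* (`CMap.IsCritical`) if it has no colouring while every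
deletion of an edge leaves a map that has one.

Criticality gives most of the theorem.  Gluings only add adjacencies between the images of vertices,
so a colouring of the target of an epimorphism pulls back to its source (`CMap.Epi.hasColoring`).
A homomorphism from a critical map to a proper submap of a critical map would therefore make the
first map colourable; hence critical maps are map cores, and, for the same reason, their graphs are
graph cores.  An odd cycle shorter than `N` would miss an edge, so it would have a colouring, but
odd closed walks in the `N`-cycle have length at least `N`; hence a critical map with an `N`-cycle
has odd girth `N` (`CMap.IsCritical.hasOddGirth`).  Finally, a homomorphism between critical maps
with the same numbers of vertices and crosses has to be onto, and since every gluing lowers one of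
these numbers, it is an isomorphism and preserves degrees
(`CMap.IsCritical.exists_numCrosses_eq_of_hom`).

It remains to find sufficiently many critical plane maps of the same size with a common image.
Replacing an edge by a path of length `N - 2` relaxes the condition that the colours of its ends
are adjacent to the condition that they are distinct (`RotationSystem.isWalkDiff_iff_ne_zero`);
such an edge is called *weak*, the others *strong*.  Take a wheel whose rim consists of an odd
number `m` of blocks `b, c, d`, in which the spokes to the `b` and the rim edges `c d` are weak
and all other edges are strong.  If the hub has colour `0`, then `c = ε` and `d = -ε` with `ε = 1`
or `ε = -1`, and the strong edges before and after a `b` with neighbours `d' = -ε'` and `c = ε`,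
together with `b ≠ 0`, force `ε = -ε'` and `b = 2 ε`.  So the signs alternate from block to block,
which is impossible around a rim with an odd number of blocks; but the deletion of any edge leaves
enough room to repair the pattern at one block.

For odd `j < m` split the hub into two, one with the spokes to the blocks `0, …, j - 1` and to the
`b` of block `j`, the other with the remaining spokes.  Identifying the two hubs is a single vertex
gluing onto the wheel (`vertexGluing_splitMap`), so colourings after the deletion of an edge are
inherited from the wheel.  The split wheel still has no colouring: with `h` the colour of the first
hub, alternation gives `b = h + 2 s` in block `0` and `b = h - 2 s` in block `j` with `s = 1` or
`s = -1`, whereas alternation at the second hub makes the `c` of block `j` and the `d` of the last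
block equal, so `4 s` would be a sum of two signs, which is impossible modulo `2 k + 1 ≥ 7`
(`not_hasColoring_splitMap`).  The first hub has degree `3 j + 1`, the second
`3 m - 3 j - 1`, and all other degrees are at most `3`, so split wheels with different `j` have no
homomorphisms to each other (`not_hom_splitMap`).
-/

/-! ### Colourings by odd cycles -/

namespace CMap

/-- A colouring, with the vertices of the cycle of length `N` as colours, of the edges in `S`: the
two ends of every edge with a cross in `S` receive adjacent colours. -/
def HasColoring (M : CMap) (N : ℕ) (S : Set M.C) : Prop :=
  ∃ f : M.V → ZMod N, ∀ c ∈ S,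
    f (M.vert (M.a0 c)) - f (M.vert c) = 1 ∨ f (M.vert (M.a0 c)) - f (M.vert c) = -1

/-- A map is critical with respect to colourings by the cycle of length `N` if it has no such
colouring but the deletion of any edge makes it colourable, and it has no isolated vertices. -/
structure IsCritical (M : CMap) (N : ℕ) : Prop where
  not_hasColoring : ¬ M.HasColoring N Set.univ
  hasColoring_delete : ∀ c₀, M.HasColoring N {c | M.edge c ≠ M.edge c₀}
  exists_vert_eq : ∀ v, ∃ c, M.vert c = v

theorem HasColoring.mono {M : CMap} {N : ℕ} {S T : Set M.C} (h : M.HasColoring N T) (hST : S ⊆ T) :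
    M.HasColoring N S := by
  obtain ⟨f, hf⟩ := h
  exact ⟨f, fun c hc => hf c (hST hc)⟩

theorem edge_a0 (M : CMap) (c : M.C) : M.edge (M.a0 c) = M.edge c :=
  (Quotient.sound (s := M.edgeSetoid) (Relation.EqvGen.rel _ _ (Or.inl rfl))).symm

theorem edge_a2 (M : CMap) (c : M.C) : M.edge (M.a2 c) = M.edge c :=
  (Quotient.sound (s := M.edgeSetoid) (Relation.EqvGen.rel _ _ (Or.inr rfl))).symm

theorem edge_eq_cases (M : CMap) {c d : M.C} (h : M.edge c = M.edge d) :
    d = c ∨ d = M.a0 c ∨ d = M.a2 c ∨ d = M.a0 (M.a2 c) :=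
  M.edgeSetoid_cases (Quotient.exact h)

theorem Submap.edge_ne_of_mem {M : CMap} (N : Submap M) {c c₀ : M.C} (hc : c ∈ N.crosses)
    (hc₀ : c₀ ∉ N.crosses) : M.edge c ≠ M.edge c₀ := by
  intro h
  rcases M.edge_eq_cases h with rfl | rfl | rfl | rfl
  · exact hc₀ hc
  · exact hc₀ (N.a0_mem _ hc)
  · exact hc₀ (N.a2_mem _ hc)
  · exact hc₀ (N.a0_mem _ (N.a2_mem _ hc))

theorem HasColoring.toMap {M : CMap} {n : ℕ} {S : Set M.C} (h : M.HasColoring n S)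
    (N : Submap M) (hN : N.crosses ⊆ S) : N.toMap.HasColoring n Set.univ := by
  obtain ⟨f, hf⟩ := h
  exact ⟨fun v => f v.1, fun c _ => hf c.1 (hN c.2)⟩

theorem Submap.IsProper.crosses_ne {M : CMap} {N : Submap M} (h : N.IsProper)
    (hM : ∀ v, ∃ c, M.vert c = v) : N.crosses ≠ Set.univ := by
  rcases h with h | h
  · intro hc
    apply h
    rw [Set.eq_univ_iff_forall]
    intro v
    obtain ⟨c, rfl⟩ := hM v
    exact N.vert_mem c (hc ▸ Set.mem_univ c)
  · exact h

theorem IsCritical.hasColoring_toMap {M : CMap} {n : ℕ} (hM : M.IsCritical n) {N : Submap M}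
    (h : N.crosses ≠ Set.univ) : N.toMap.HasColoring n Set.univ := by
  obtain ⟨c₀, hc₀⟩ := (Set.ne_univ_iff_exists_notMem _).1 h
  exact (hM.hasColoring_delete c₀).toMap N fun c hc => N.edge_ne_of_mem hc hc₀

/-! ### Colourings and gluings -/

theorem VertexGluing.hasColoring {M M' : CMap} {N : ℕ} (h : VertexGluing M M')
    (hc : M'.HasColoring N Set.univ) : M.HasColoring N Set.univ := by
  obtain ⟨u, v, p, j, -, -, -, hv, h0, -⟩ := h
  obtain ⟨f, hf⟩ := hc
  refine ⟨fun x => f (p x), fun c _ => ?_⟩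
  have := hf (j c) trivial
  rwa [h0, hv, hv] at this

theorem VertexGluing.card_C {M M' : CMap} (h : VertexGluing M M') :
    Nat.card M'.C = Nat.card M.C := by
  obtain ⟨u, v, p, j, -⟩ := h
  exact (Nat.card_congr j).symm

theorem VertexGluing.card_V_lt {M M' : CMap} (h : VertexGluing M M') :
    Nat.card M'.V < Nat.card M.V := by
  obtain ⟨u, v, p, j, huv, hp, hpe, -⟩ := h
  have := M.finV
  have := M'.finV
  have := Fintype.ofFinite M.V
  have := Fintype.ofFinite M'.V
  rw [Nat.card_eq_fintype_card, Nat.card_eq_fintype_card]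
  refine Fintype.card_lt_of_surjective_not_injective p hp fun hi => huv (hi ?_)
  exact (hpe u v).2 (Or.inr (Or.inl ⟨rfl, rfl⟩))

/-- The deleted crosses `a`, `a0 a`, `b`, `a0 b` have the same ends as the remaining crosses
`a2 a`, `a2 (a0 a)`, `a2 b`, `a2 (a0 b)`, so the gluing keeps all adjacencies. -/
theorem DuplicateGluing.hasColoring {M M' : CMap} {N : ℕ} (h : DuplicateGluing M M')
    (hc : M'.HasColoring N Set.univ) : M.HasColoring N Set.univ := by
  obtain ⟨a, b, p, j, -, -, hab, -, hr, hv, h0, -⟩ := h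
  obtain ⟨f, hf⟩ := hc
  refine ⟨fun x => f (p.symm x), ?_⟩
  have key : ∀ c ∈ Set.range j, f (p.symm (M.vert (M.a0 c))) - f (p.symm (M.vert c)) = 1 ∨
      f (p.symm (M.vert (M.a0 c))) - f (p.symm (M.vert c)) = -1 := by
    rintro _ ⟨c, rfl⟩
    have := hf c trivial
    rwa [← h0, ← hv, ← hv, p.symm_apply_apply, p.symm_apply_apply]
  intro c _
  by_cases hcr : c ∈ Set.range j
  · exact key c hcr
  · have h2 : M.a2 c ∈ Set.range j := by
      have hab' : ∀ x y, M.edge x = M.edge a → M.edge y = M.edge b → x ≠ y := by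
        rintro x y hx hy rfl
        exact hab (hx.symm.trans hy)
      rw [hr, Set.mem_compl_iff, not_not] at hcr
      rw [hr]
      simp only [Set.mem_insert_iff, Set.mem_singleton_iff] at hcr
      simp only [Set.mem_compl_iff, Set.mem_insert_iff, Set.mem_singleton_iff, not_or]
      rcases hcr with rfl | rfl | rfl | rfl
      · exact ⟨M.a2_ne _, fun h => M.a0_a2_ne c (by rw [h, M.a0_a0]),
          hab' _ _ (by rw [edge_a2]) rfl, hab' _ _ (by rw [edge_a2]) (by rw [edge_a0])⟩
      · exact ⟨fun h => M.a0_a2_ne a (by rw [M.a0_a2_comm, h]), M.a2_ne _,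
          hab' _ _ (by rw [edge_a2, edge_a0]) rfl,
          hab' _ _ (by rw [edge_a2, edge_a0]) (by rw [edge_a0])⟩
      · exact ⟨(hab' _ _ rfl (by rw [edge_a2])).symm,
          (hab' _ _ (by rw [edge_a0]) (by rw [edge_a2])).symm, M.a2_ne _,
          fun h => M.a0_a2_ne c (by rw [h, M.a0_a0])⟩
      · exact ⟨(hab' _ _ rfl (by rw [edge_a2, edge_a0])).symm,
          (hab' _ _ (by rw [edge_a0]) (by rw [edge_a2, edge_a0])).symm,
          fun h => M.a0_a2_ne b (by rw [M.a0_a2_comm, h]), M.a2_ne _⟩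
    have := key _ h2
    rwa [M.a0_a2_comm, M.vert_a2, M.vert_a2] at this

theorem DuplicateGluing.card_V {M M' : CMap} (h : DuplicateGluing M M') :
    Nat.card M'.V = Nat.card M.V := by
  obtain ⟨a, b, p, -⟩ := h
  exact Nat.card_congr p

theorem DuplicateGluing.card_C_lt {M M' : CMap} (h : DuplicateGluing M M') :
    Nat.card M'.C < Nat.card M.C := by
  obtain ⟨a, b, p, j, -, -, -, hj, hr, -⟩ := h
  have := M.finC
  have := M'.finC
  have := Fintype.ofFinite M.C
  have := Fintype.ofFinite M'.C
  rw [Nat.card_eq_fintype_card, Nat.card_eq_fintype_card]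
  refine Fintype.card_lt_of_injective_of_notMem j hj (b := a) ?_
  rw [hr]
  simp

theorem Iso.hasColoring {M M' : CMap} {N : ℕ} (h : Iso M M') (hc : M'.HasColoring N Set.univ) :
    M.HasColoring N Set.univ := by
  obtain ⟨p, j, hv, h0, -⟩ := h
  obtain ⟨f, hf⟩ := hc
  refine ⟨fun x => f (p x), fun c _ => ?_⟩
  have := hf (j c) trivial
  rwa [h0, hv, hv] at this

theorem Epi.hasColoring {M M' : CMap} {N : ℕ} (h : Epi M M') (hc : M'.HasColoring N Set.univ) :
    M.HasColoring N Set.univ := by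
  obtain ⟨-, P, Q, hMP, hPQ, hQ⟩ := h
  have h1 := hQ.hasColoring hc
  have h2 : P.HasColoring N Set.univ := by
    clear hQ hMP
    induction hPQ with
    | refl => exact h1
    | tail _ h ih => exact ih (h.hasColoring h1)
  clear h1 hPQ
  induction hMP with
  | refl => exact h2
  | tail _ h ih => exact ih (h.hasColoring h2)

/-- Every gluing lowers the number of vertices or the number of crosses, so an epimorphism between
maps of the same size is an isomorphism. -/
theorem Epi.iso_of_card_le {M M' : CMap} (h : Epi M M') (hV : Nat.card M.V ≤ Nat.card M'.V)
    (hC : Nat.card M.C ≤ Nat.card M'.C) : Iso M M' := by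
  obtain ⟨-, P, Q, hMP, hPQ, hQ⟩ := h
  have h1 : Nat.card Q.V = Nat.card M'.V ∧ Nat.card Q.C = Nat.card M'.C := by
    obtain ⟨p, j, -⟩ := hQ
    exact ⟨Nat.card_congr p, Nat.card_congr j⟩
  have h2 : Nat.card P.C = Nat.card M.C ∧ Nat.card P.V ≤ Nat.card M.V ∧
      (Nat.card P.V = Nat.card M.V → P = M) := by
    clear hPQ
    induction hMP with
    | refl => exact ⟨rfl, le_rfl, fun _ => rfl⟩
    | tail _ h ih =>
      have := h.card_C
      have := h.card_V_lt
      exact ⟨by omega, by omega, fun _ => by omega⟩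
  have h3 : Nat.card Q.V = Nat.card P.V ∧ Nat.card Q.C ≤ Nat.card P.C ∧
      (Nat.card Q.C = Nat.card P.C → Q = P) := by
    clear hMP hQ h2 h1
    induction hPQ with
    | refl => exact ⟨rfl, le_rfl, fun _ => rfl⟩
    | tail _ h ih =>
      have := h.card_V
      have := h.card_C_lt
      exact ⟨by omega, by omega, fun _ => by omega⟩
  obtain rfl := h3.2.2 (by omega)
  obtain rfl := h2.2.2 (by omega)
  exact hQ

/-! ### Critical maps are cores -/

theorem IsCritical.isCore {M : CMap} {n : ℕ} (hM : M.IsCritical n) : M.IsCore := by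
  intro N hN ⟨_, N', hN'⟩
  refine hM.not_hasColoring (hN'.hasColoring ?_)
  obtain ⟨f, hf⟩ := hM.hasColoring_toMap (hN.crosses_ne hM.exists_vert_eq)
  exact HasColoring.toMap ⟨f, hf⟩ N' (Set.subset_univ _)

theorem IsCritical.isGraphCore {M : CMap} {n : ℕ} (hM : M.IsCritical n) :
    IsGraphCore M.graph := by
  rintro H hle hne ⟨f, hfV, hf⟩
  obtain ⟨e, he⟩ : ∃ e, e ∉ H.edgeSet := by
    by_contra hall
    push Not at hall
    have hV : H.vertexSet = M.graph.vertexSet := by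
      refine Set.Subset.antisymm hle.vertexSet_mono ?_
      intro v _
      obtain ⟨c, rfl⟩ := hM.exists_vert_eq v
      obtain ⟨x, y, hxy⟩ := H.exists_isLink_of_mem_edgeSet (hall (M.edge c))
      have h1 := hle.isLink_mono hxy
      have h2 : M.graph.IsLink (M.edge c) (M.vert c) (M.vert (M.a0 c)) := ⟨c, rfl, rfl, rfl⟩
      rcases h1.left_eq_or_eq h2 with h | h
      · exact h ▸ hxy.left_mem
      · have : y = M.vert c := by
          rw [h] at h1
          exact h1.right_unique h2.symm
        exact this ▸ hxy.right_mem
    apply hne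
    refine Graph.ext hV fun e x y => ⟨fun h => hle.isLink_mono h, fun h => ?_⟩
    obtain ⟨x', y', hxy⟩ := H.exists_isLink_of_mem_edgeSet (hall e)
    rcases Graph.IsLink.eq_and_eq_or_eq_and_eq (hle.isLink_mono hxy) h with ⟨rfl, rfl⟩ | ⟨rfl, rfl⟩
    · exact hxy
    · exact hxy.symm
  obtain ⟨c₀, rfl⟩ := Quotient.exists_rep e
  obtain ⟨g, hg⟩ := hM.hasColoring_delete c₀
  refine hM.not_hasColoring ⟨fun v => g (f v), fun c _ => ?_⟩
  obtain ⟨e', he'⟩ := hf (M.edge c) (M.vert c) (M.vert (M.a0 c)) ⟨c, rfl, rfl, rfl⟩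
  obtain ⟨d, hd, hd1, hd2⟩ := hle.isLink_mono he'
  have := hg d (by
    intro h
    apply he
    have : e' = Quotient.mk M.edgeSetoid c₀ := hd.symm.trans h
    exact this ▸ he'.edge_mem)
  rwa [hd1, hd2] at this

/-! ### Odd girth of critical maps -/

/-- A closed walk of odd length in a cycle of length `N` winds around it, so it has length at
least `N`. -/
theorem le_of_closed_walk {N l : ℕ} [NeZero l] (hl : Odd l) (g : ZMod l → ZMod N)
    (hg : ∀ i, g (i + 1) - g i = 1 ∨ g (i + 1) - g i = -1) : N ≤ l := by
  have hε : ∀ i, ∃ ε : ℤ, (ε = 1 ∨ ε = -1) ∧ g (i + 1) - g i = ε := by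
    intro i
    rcases hg i with h | h
    · exact ⟨1, Or.inl rfl, by simp [h]⟩
    · exact ⟨-1, Or.inr rfl, by simp [h]⟩
  choose ε hε1 hε2 using hε
  have hsum : ((∑ i, ε i : ℤ) : ZMod N) = 0 := by
    push_cast
    rw [← Finset.sum_congr rfl fun i _ => hε2 i, Finset.sum_sub_distrib, sub_eq_zero]
    exact Equiv.sum_comp (Equiv.addRight 1) g
  have habs : |∑ i, ε i| ≤ l := by
    refine (Finset.abs_sum_le_sum_abs _ _).trans ?_
    have : ∀ i, |ε i| = 1 := fun i => by rcases hε1 i with h | h <;> simp [h]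
    simp [this, ZMod.card]
  have hodd : Odd (∑ i, ε i) := by
    have h2 : ((∑ i, ε i : ℤ) : ZMod 2) = 1 := by
      have : ∀ i, ((ε i : ℤ) : ZMod 2) = 1 := fun i => by
        rcases hε1 i with h | h <;> rw [h] <;> decide
      push_cast
      simp only [this, Finset.sum_const, Finset.card_univ, ZMod.card, nsmul_eq_mul, mul_one]
      exact (ZMod.natCast_eq_one_iff_odd).2 hl
    exact (ZMod.intCast_eq_one_iff_odd).1 h2
  have hdvd := (ZMod.intCast_zmod_eq_zero_iff_dvd _ _).1 hsum
  have hne : ∑ i, ε i ≠ 0 := fun h => by simp [h] at hodd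
  have := Int.le_of_dvd (abs_pos.2 hne) ((dvd_abs _ _).2 hdvd)
  omega

/-- An odd cycle of a critical map either misses an edge, so that it has a colouring, or it contains
all edges. -/
theorem IsCritical.hasOddGirth {M : CMap} {n : ℕ} (hM : M.IsCritical n) (hn : Odd n)
    (h : HasCycle M.graph n) : HasOddGirth M.graph n := by
  refine ⟨⟨hn, h⟩, ?_⟩
  rintro l ⟨hl, hl1, x, e, -, he, hlink⟩
  have : NeZero l := ⟨by omega⟩
  have : NeZero n := ⟨by rintro rfl; simp at hn⟩
  have := M.finC
  by_cases hs : Function.Surjective e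
  · obtain ⟨-, -, e', -, he', -⟩ := h
    have : Finite M.Edge := Quotient.finite _
    have h1 := Nat.card_le_card_of_surjective e hs
    have h2 := Nat.card_le_card_of_injective e' he'
    rw [Nat.card_zmod] at h1 h2
    exact h2.trans h1
  · simp only [Function.Surjective, not_forall, not_exists] at hs
    obtain ⟨e₀, he₀⟩ := hs
    obtain ⟨c₀, rfl⟩ := Quotient.exists_rep e₀
    obtain ⟨g, hg⟩ := hM.hasColoring_delete c₀
    refine le_of_closed_walk hl (fun i => g (x i)) fun i => ?_
    obtain ⟨c, hc, hc1, hc2⟩ := hlink i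
    have := hg c (hc.trans_ne (he₀ i))
    rwa [hc1, hc2] at this

/-! ### Homomorphisms between critical maps of the same size -/

/-- The number of crosses at a vertex, that is, twice its degree. -/
noncomputable def numCrosses (M : CMap) (v : M.V) : ℕ := Nat.card {c // M.vert c = v}

/-- A homomorphism between critical maps of the same size is an isomorphism; in particular it
respects degrees. -/
theorem IsCritical.exists_numCrosses_eq_of_hom {M M' : CMap} {n : ℕ} (hM : M.IsCritical n)
    (hM' : M'.IsCritical n) (hV : Nat.card M.V = Nat.card M'.V)
    (hC : Nat.card M.C = Nat.card M'.C) (h : Hom M M') (v : M.V) :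
    ∃ v', M'.numCrosses v' = M.numCrosses v := by
  obtain ⟨-, N, hN⟩ := h
  have hcr : N.crosses = Set.univ := by
    by_contra hne
    exact hM.not_hasColoring (hN.hasColoring (hM'.hasColoring_toMap hne))
  have hve : N.verts = Set.univ := by
    by_contra hne
    exact Submap.IsProper.crosses_ne (Or.inl hne) hM'.exists_vert_eq hcr
  have hV' : Nat.card N.toMap.V = Nat.card M'.V := by
    show Nat.card N.verts = _
    rw [hve, Nat.card_coe_set_eq, Set.ncard_univ]
  have hC' : Nat.card N.toMap.C = Nat.card M'.C := by
    show Nat.card N.crosses = _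
    rw [hcr, Nat.card_coe_set_eq, Set.ncard_univ]
  obtain ⟨p, j, hv, -⟩ := hN.iso_of_card_le (by omega) (by omega)
  refine ⟨(p v).1, Nat.card_congr (Equiv.symm ?_)⟩
  refine (j.subtypeEquiv (q := fun c => N.toMap.vert c = p v) fun c => ?_).trans
    ((Equiv.subtypeUnivEquiv fun c => hcr ▸ Set.mem_univ c).subtypeEquiv fun c => ?_)
  · rw [hv, p.apply_eq_iff_eq]
  · exact Subtype.ext_iff

end CMap

/-! ### Isomorphic maps have the same genus -/

theorem eqvGen_map {α β : Type} {r : α → α → Prop} {s : β → β → Prop} (f : α → β)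
    (h : ∀ x y, r x y → s (f x) (f y)) {x y : α} (hxy : Relation.EqvGen r x y) :
    Relation.EqvGen s (f x) (f y) := by
  induction hxy with
  | rel x y hxy => exact Relation.EqvGen.rel _ _ (h x y hxy)
  | refl x => exact Relation.EqvGen.refl _
  | symm x y _ ih => exact Relation.EqvGen.symm _ _ ih
  | trans x y z _ _ ih1 ih2 => exact Relation.EqvGen.trans _ _ _ ih1 ih2

theorem eqvGen_equiv_iff {α β : Type} {r : α → α → Prop} {s : β → β → Prop} (f : α ≃ β)
    (h : ∀ x y, r x y ↔ s (f x) (f y)) (x y : α) :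
    Relation.EqvGen r x y ↔ Relation.EqvGen s (f x) (f y) := by
  refine ⟨eqvGen_map f fun x y => (h x y).1, fun hxy => ?_⟩
  have := eqvGen_map (s := r) f.symm (fun x y hxy => (h _ _).2 (by simpa using hxy)) hxy
  simpa using this

namespace CMap

theorem Iso.signedGenus_eq {M M' : CMap} (h : Iso M M') : M.signedGenus = M'.signedGenus := by
  obtain ⟨p, j, hv, h0, h1, h2⟩ := h
  have hedge : M.numEdges = M'.numEdges :=
    Nat.card_congr (Quotient.congr j (eqvGen_equiv_iff j fun x y => by simp [h0, h2]))
  have hface : Nat.card (Quotient M.faceSetoid) = Nat.card (Quotient M'.faceSetoid) :=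
    Nat.card_congr (Quotient.congr j (eqvGen_equiv_iff j fun x y => by simp [h0, h1]))
  have hcomp : Nat.card (Quotient M.compSetoid) = Nat.card (Quotient M'.compSetoid) :=
    Nat.card_congr (Quotient.congr j (eqvGen_equiv_iff j fun x y => by simp [h0, h1, h2]))
  have hvert : M.numVertices = M'.numVertices := Nat.card_congr p
  have hisol : M.numIsolated = M'.numIsolated := by
    refine Nat.card_congr (p.subtypeEquiv fun v => ?_)
    show (∀ c, _) ↔ ∀ c, _
    rw [← j.forall_congr_right]
    simp [hv]
  have horient : M.IsOrientable ↔ M'.IsOrientable := by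
    show (∀ c, _) ↔ ∀ c, _
    rw [← j.forall_congr_right]
    refine forall_congr' fun c => not_congr ?_
    rw [h2]
    exact eqvGen_equiv_iff j (fun x y => by simp [h0, h1, h2]) c (M.a2 c)
  have heuler : M.eulerGenus = M'.eulerGenus := by
    simp only [eulerGenus, numComponents, numFaces, hedge, hface, hcomp, hvert, hisol]
  by_cases h : M.IsOrientable
  · simp [signedGenus, h, horient.1 h, heuler]
  · simp [signedGenus, h, mt horient.2 h, heuler]

/-- The whole map as a submap. -/
def Submap.full (M : CMap) : Submap M where
  verts := Set.univ
  crosses := Set.univ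
  a0_mem _ _ := trivial
  a2_mem _ _ := trivial
  vert_mem _ _ := trivial

theorem Submap.iso_full (M : CMap) : Iso M (Submap.full M).toMap := by
  refine ⟨(Equiv.Set.univ _).symm, (Equiv.Set.univ _).symm, fun c => rfl, fun c => rfl,
    fun c => ?_, fun c => rfl⟩
  have hs : (Submap.full M).skip ((Equiv.Set.univ _).symm c) = 0 :=
    Nat.le_zero.1 ((Submap.full M).skip_le _ trivial)
  refine Subtype.ext ?_
  show M.tau^[(Submap.full M).skip ((Equiv.Set.univ _).symm c)] (M.a1 c) = M.a1 c
  rw [hs]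
  rfl

theorem VertexGluing.epi {M M' : CMap} (h : VertexGluing M M')
    (hg : M.signedGenus = M'.signedGenus) : Epi M M' :=
  ⟨hg, M', M', Relation.ReflTransGen.single h, Relation.ReflTransGen.refl,
    Equiv.refl _, Equiv.refl _, fun _ => rfl, fun _ => rfl, fun _ => rfl, fun _ => rfl⟩

theorem VertexGluing.hom {M M' : CMap} (h : VertexGluing M M')
    (hg : M.signedGenus = M'.signedGenus) : Hom M M' :=
  ⟨hg, Submap.full M', hg.trans (Submap.iso_full M').signedGenus_eq, M', M',
    Relation.ReflTransGen.single h, Relation.ReflTransGen.refl, Submap.iso_full M'⟩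

end CMap

/-! ### Rotation systems -/

theorem Equiv.Perm.SameCycle.setoid_rel {α : Type} {f : Equiv.Perm α} (s : Setoid α)
    (h : ∀ x, s x (f x)) {x y : α} (hxy : f.SameCycle x y) : s x y := by
  obtain ⟨i, rfl⟩ := hxy
  induction i with
  | zero => exact s.refl _
  | succ i ih =>
    refine s.trans ih ?_
    have := h ((f ^ (i : ℤ)) x)
    rwa [← Equiv.Perm.mul_apply, ← zpow_one_add, add_comm] at this
  | pred i ih =>
    refine s.trans ih (s.symm ?_)
    have := h ((f ^ (-(i : ℤ) - 1)) x)
    rwa [← Equiv.Perm.mul_apply, ← zpow_one_add, add_sub_cancel] at this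

theorem Equiv.Perm.SameCycle.apply_eq {α β : Type} {f : Equiv.Perm α} (g : α → β)
    (h : ∀ x, g (f x) = g x) {x y : α} (hxy : f.SameCycle x y) : g x = g y :=
  hxy.setoid_rel (Setoid.ker g) fun x => (h x).symm

/-- A rotation system: the dart `(e, true)` is the edge `e` directed away from its first end, and
`(e, false)` is the same edge directed away from its second end; `rot` permutes the darts cyclically
around the vertex that they leave. -/
structure RotationSystem where
  /-- vertices -/
  V : Type
  /-- edges -/
  E : Type
  finV : Finite V
  finE : Finite E
  /-- the next dart around the same vertex -/
  rot : Equiv.Perm (E × Bool)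
  /-- the vertex that a dart leaves -/
  vert : E × Bool → V
  vert_surjective : Function.Surjective vert
  vert_eq_iff : ∀ x y, vert x = vert y ↔ rot.SameCycle x y

/-- Reversal of darts. -/
def revDart (E : Type) : Equiv.Perm (E × Bool) :=
  (Function.Involutive.toPerm (fun x => (x.1, !x.2)) fun x => by simp)

@[simp]
theorem revDart_apply {E : Type} (e : E) (d : Bool) : revDart E (e, d) = (e, !d) := rfl

@[simp]
theorem revDart_revDart {E : Type} (x : E × Bool) : revDart E (revDart E x) = x :=
  Equiv.apply_symm_apply (revDart E) x

namespace RotationSystem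

variable (R : RotationSystem)

/-- The face permutation of the darts. -/
def face : Equiv.Perm (R.E × Bool) := (revDart R.E).trans R.rot

theorem face_apply (x : R.E × Bool) : R.face x = R.rot (revDart R.E x) := rfl

/-- The map of a rotation system: every dart has two crosses, one for each side, exchanged by
`a2`. -/
def toCMap : CMap where
  V := R.V
  C := (R.E × Bool) × Bool
  finV := R.finV
  finC := haveI := R.finE; inferInstance
  a0 c := (revDart R.E c.1, !c.2)
  a1 c := (cond c.2 (R.rot.symm c.1) (R.rot c.1), !c.2)
  a2 c := (c.1, !c.2)
  a0_a0 c := by simp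
  a1_a1 := by rintro ⟨x, _ | _⟩ <;> simp
  a2_a2 c := by simp
  a0_ne c h := by simpa using congrArg Prod.snd h
  a1_ne c h := by simpa using congrArg Prod.snd h
  a2_ne c h := by simpa using congrArg Prod.snd h
  a0_a2_comm c := rfl
  a0_a2_ne := by
    rintro ⟨⟨e, d⟩, s⟩ h
    simpa using congrArg (fun c => c.1.2) h
  vert c := R.vert c.1
  vert_eq_iff c d := by
    obtain ⟨x, s⟩ := c
    obtain ⟨y, t⟩ := d
    rw [R.vert_eq_iff]
    constructor
    · intro h
      let S : Setoid ((R.E × Bool) × Bool) := Relation.EqvGen.setoid (fun x y =>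
        y = ((cond x.2 (R.rot.symm x.1) (R.rot x.1), !x.2) : (R.E × Bool) × Bool) ∨
          y = (x.1, !x.2))
      have h2 : ∀ (z : R.E × Bool) (s : Bool), S (z, s) (z, !s) := fun z s =>
        Relation.EqvGen.rel _ _ (Or.inr rfl)
      have h3 : ∀ (z : R.E × Bool) (s t : Bool), S (z, s) (z, t) := by
        intro z s t
        by_cases hst : t = s
        · exact hst ▸ S.refl _
        · have : t = !s := by revert hst; cases s <;> cases t <;> decide
          exact this ▸ h2 z s
      have h1 : ∀ z, S (z, true) (R.rot z, true) := fun z =>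
        S.trans (h2 z true) (Relation.EqvGen.rel (z, false) _ (Or.inl rfl))
      exact S.trans (h3 x s true) (S.trans
        (h.setoid_rel (S.comap fun z => (z, true)) h1) (h3 y true t))
    · intro h
      let S : Setoid (R.E × Bool) := ⟨R.rot.SameCycle, Equiv.Perm.SameCycle.equivalence _⟩
      change S x y
      have : ∀ c d : (R.E × Bool) × Bool, Relation.EqvGen (fun x y =>
        y = ((cond x.2 (R.rot.symm x.1) (R.rot x.1), !x.2) : (R.E × Bool) × Bool) ∨
          y = (x.1, !x.2)) c d → S c.1 d.1 := by
        intro c d h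
        induction h with
        | rel c d h =>
          rcases h with rfl | rfl
          · obtain ⟨x, _ | _⟩ := c
            · exact (Equiv.Perm.sameCycle_apply_right).2 (Equiv.Perm.SameCycle.refl _ _)
            · exact (Equiv.Perm.sameCycle_symm_apply_right).2 (Equiv.Perm.SameCycle.refl _ _)
          · exact S.refl _
        | refl x => exact S.refl _
        | symm x y _ ih => exact S.symm ih
        | trans x y z _ _ ih1 ih2 => exact S.trans ih1 ih2
      exact this _ _ h

theorem edge_eq_iff (c d : R.toCMap.C) :
    R.toCMap.edge c = R.toCMap.edge d ↔ c.1.1 = d.1.1 := by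
  constructor
  · intro h
    rcases R.toCMap.edge_eq_cases h with rfl | rfl | rfl | rfl <;> rfl
  · obtain ⟨⟨e', d'⟩, s'⟩ := d
    obtain ⟨⟨e, d⟩, s⟩ := c
    intro he
    obtain rfl : e = e' := he
    have h2 : ∀ d s s', R.toCMap.edge ((e, d), s) = R.toCMap.edge ((e, d), s') := by
      intro d s s'
      by_cases h : s' = s
      · rw [h]
      · have : s' = !s := by revert h; cases s <;> cases s' <;> decide
        rw [this]
        exact (R.toCMap.edge_a2 ((e, d), s)).symm
    by_cases h : d' = d
    · rw [h]
      exact h2 d s s'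
    · have : d' = !d := by revert h; cases d <;> cases d' <;> decide
      rw [this]
      exact (R.toCMap.edge_a0 ((e, d), s)).symm.trans (h2 _ _ _)

/-- A rotation system is connected if some dart reaches all others by rotations and reversals,
stated as an induction principle. -/
def Connected : Prop :=
  ∃ x₀, ∀ P : R.E × Bool → Prop, P x₀ → (∀ x, P x ↔ P (R.rot x)) →
    (∀ x, P x ↔ P (revDart R.E x)) → ∀ x, P x

theorem numIsolated_eq_zero : R.toCMap.numIsolated = 0 := by
  have : IsEmpty {v : R.toCMap.V // R.toCMap.IsIsolated v} := by
    refine ⟨fun ⟨v, hv⟩ => ?_⟩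
    obtain ⟨x, hx⟩ := R.vert_surjective v
    exact hv (x, true) hx
  exact Nat.card_of_isEmpty

variable {R}

theorem Connected.isConnected (h : R.Connected) : R.toCMap.IsConnected := by
  obtain ⟨x₀, h⟩ := h
  have h0 : ∀ c, R.toCMap.compSetoid c (R.toCMap.a0 c) := fun c =>
    Relation.EqvGen.rel _ _ (Or.inl rfl)
  have h1 : ∀ c, R.toCMap.compSetoid c (R.toCMap.a1 c) := fun c =>
    Relation.EqvGen.rel _ _ (Or.inr (Or.inl rfl))
  have h2 : ∀ c, R.toCMap.compSetoid c (R.toCMap.a2 c) := fun c =>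
    Relation.EqvGen.rel _ _ (Or.inr (Or.inr rfl))
  have htr := fun c d e (h : R.toCMap.compSetoid c d) => R.toCMap.compSetoid.trans (c := e) h
  have hall : ∀ x, R.toCMap.compSetoid (x₀, true) (x, true) := by
    refine h _ (R.toCMap.compSetoid.refl _) (fun x => ?_) fun x => ?_
    · have hs : R.toCMap.compSetoid (x, true) (R.rot x, true) :=
        htr _ _ _ (h2 (x, true)) (h1 (x, false))
      exact ⟨fun h => htr _ _ _ h hs, fun h => htr _ _ _ h (R.toCMap.compSetoid.symm hs)⟩
    · have hs : R.toCMap.compSetoid (x, true) (revDart _ x, true) :=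
        htr _ _ _ (h2 (x, true)) (h0 (x, false))
      exact ⟨fun h => htr _ _ _ h hs, fun h => htr _ _ _ h (R.toCMap.compSetoid.symm hs)⟩
  have hall' : ∀ c, R.toCMap.compSetoid (x₀, true) c := by
    rintro ⟨x, _ | _⟩
    · exact htr _ _ _ (hall x) (h2 (x, true))
    · exact hall x
  show Nat.card (Quotient R.toCMap.compSetoid) + R.toCMap.numIsolated = 1
  rw [numIsolated_eq_zero, add_zero, Nat.card_eq_one_iff_unique]
  refine ⟨⟨fun a b => ?_⟩, ⟨Quotient.mk _ (x₀, true)⟩⟩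
  induction a using Quotient.inductionOn
  induction b using Quotient.inductionOn
  exact Quotient.sound (htr _ _ _ (R.toCMap.compSetoid.symm (hall' _)) (hall' _))

theorem isOrientable : R.toCMap.IsOrientable := by
  intro c h
  have key : ∀ c d : R.toCMap.C, R.toCMap.orientSetoid c d → c.2 = d.2 := by
    intro c d h
    have h' : Relation.EqvGen (fun x y => y = R.toCMap.a0 (R.toCMap.a2 x) ∨
      y = R.toCMap.a1 (R.toCMap.a2 x)) c d := h
    clear h
    induction h' with
    | rel c d h =>
      rcases h with rfl | rfl
      · exact (Bool.not_not _).symm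
      · exact (Bool.not_not _).symm
    | refl x => rfl
    | symm x y _ ih => exact ih.symm
    | trans x y z _ _ ih1 ih2 => exact ih1.trans ih2
  have : c.2 = !c.2 := key _ _ h
  simp at this

theorem card_quotient_eq {α β : Type} (s : Setoid α) (g : α → β) (hg : Function.Surjective g)
    (h : ∀ x y, g x = g y ↔ s x y) : Nat.card (Quotient s) = Nat.card β := by
  have : s = Setoid.ker g := Setoid.ext fun x y => (h x y).symm
  subst this
  exact Nat.card_congr (Setoid.quotientKerEquivOfSurjective g hg)

theorem numEdges_eq : R.toCMap.numEdges = Nat.card R.E := by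
  refine card_quotient_eq _ (fun c => c.1.1) (fun e => ⟨((e, true), true), rfl⟩) fun c d => ?_
  rw [← R.edge_eq_iff]
  exact ⟨fun h => Quotient.exact h, fun h => Quotient.sound h⟩

variable (R) in
/-- `T` is, by means of `F`, the set of faces of a rotation system. -/
structure IsFaceMap {T : Type} (F : R.E × Bool → T) : Prop where
  surjective : Function.Surjective F
  eq_iff : ∀ x y, F x = F y ↔ R.face.SameCycle x y

theorem IsFaceMap.numFaces_eq {T : Type} {F : R.E × Bool → T} (hF : R.IsFaceMap F) :
    R.toCMap.numFaces = Nat.card T := by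
  show Nat.card (Quotient R.toCMap.faceSetoid) + R.toCMap.numIsolated = _
  rw [numIsolated_eq_zero, add_zero]
  have hface : ∀ x, F (R.face x) = F x := fun x =>
    (hF.eq_iff _ _).2 (Equiv.Perm.sameCycle_apply_left.2 (Equiv.Perm.SameCycle.refl _ _))
  -- The cross `((e, d), false)` lies on the face to the left of the reversed dart.
  let G : R.toCMap.C → T := fun c => cond c.2 (F c.1) (F (revDart _ c.1))
  have hG0 : ∀ c, G (R.toCMap.a0 c) = G c := by
    rintro ⟨x, _ | _⟩
    · rfl
    · exact congrArg F (revDart_revDart x)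
  have hG1 : ∀ c, G (R.toCMap.a1 c) = G c := by
    rintro ⟨x, _ | _⟩
    · show F (R.rot x) = F (revDart _ x)
      rw [← hface (revDart _ x), face_apply, revDart_revDart]
    · show F (revDart _ (R.rot.symm x)) = F x
      rw [← hface, face_apply, revDart_revDart, Equiv.apply_symm_apply]
  have h0 : ∀ c, R.toCMap.faceSetoid c (R.toCMap.a0 c) := fun c =>
    Relation.EqvGen.rel _ _ (Or.inl rfl)
  have h1 : ∀ c, R.toCMap.faceSetoid c (R.toCMap.a1 c) := fun c =>
    Relation.EqvGen.rel _ _ (Or.inr rfl)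
  have hstep : ∀ x, R.toCMap.faceSetoid (x, true) (R.face x, true) := fun x =>
    R.toCMap.faceSetoid.trans (h0 (x, true)) (h1 (revDart _ x, false))
  have htrue : ∀ c, ∃ x, R.toCMap.faceSetoid c (x, true) := by
    rintro ⟨x, _ | _⟩
    · exact ⟨_, h0 (x, false)⟩
    · exact ⟨x, R.toCMap.faceSetoid.refl _⟩
  have hinv : ∀ c d, R.toCMap.faceSetoid c d → G c = G d := by
    intro c d h
    have h' : Relation.EqvGen (fun x y => y = R.toCMap.a0 x ∨ y = R.toCMap.a1 x) c d := h
    clear h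
    induction h' with
    | rel c d h =>
      rcases h with rfl | rfl
      · exact (hG0 c).symm
      · exact (hG1 c).symm
    | refl x => rfl
    | symm x y _ ih => exact ih.symm
    | trans x y z _ _ ih1 ih2 => exact ih1.trans ih2
  refine card_quotient_eq _ G (fun t => ?_) fun c d => ⟨fun h => ?_, hinv c d⟩
  · obtain ⟨x, rfl⟩ := hF.surjective t
    exact ⟨(x, true), rfl⟩
  · obtain ⟨x, hx⟩ := htrue c
    obtain ⟨y, hy⟩ := htrue d
    have hxy : F x = F y := (hinv _ _ hx).symm.trans (h.trans (hinv _ _ hy))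
    have := ((hF.eq_iff _ _).1 hxy).setoid_rel (R.toCMap.faceSetoid.comap fun z => (z, true)) hstep
    exact R.toCMap.faceSetoid.trans hx
      (R.toCMap.faceSetoid.trans this (R.toCMap.faceSetoid.symm hy))

/-- Euler's formula as a criterion for planarity. -/
theorem Connected.isPlane (h : R.Connected) {T : Type} {F : R.E × Bool → T} (hF : R.IsFaceMap F)
    (hcard : Nat.card R.V + Nat.card T = Nat.card R.E + 2) : R.toCMap.IsPlane := by
  have h1 : R.toCMap.numComponents = 1 := h.isConnected
  have h2 : R.toCMap.numVertices = Nat.card R.V := rfl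
  have h3 : R.toCMap.eulerGenus = 0 := by
    rw [CMap.eulerGenus, h1, h2, numEdges_eq, hF.numFaces_eq]
    push_cast
    omega
  rw [CMap.IsPlane, CMap.signedGenus, if_pos isOrientable, h3]
  simp

/-- Two darts on the same face have coincident crosses. -/
theorem IsFaceMap.faceCoincident {T : Type} {F : R.E × Bool → T} (hF : R.IsFaceMap F)
    {x y : R.E × Bool} (hxy : F x = F y) : R.toCMap.FaceCoincident (x, true) (y, true) := by
  have := R.finE
  obtain ⟨i, rfl⟩ := ((hF.eq_iff _ _).1 hxy).exists_nat_pow_eq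
  refine ⟨i, ?_⟩
  induction i with
  | zero => rfl
  | succ i ih =>
    have h1 : R.toCMap.phi^[i + 1] (x, true) = R.toCMap.phi (R.toCMap.phi^[i] (x, true)) :=
      Function.iterate_succ_apply' _ _ _
    rw [h1, ih (hF.eq_iff _ _ |>.2 ⟨i, rfl⟩), pow_succ']
    rfl

end RotationSystem

/-! ### Subdivision of edges -/

namespace RotationSystem

/-- The first dart on the path that replaces a dart. -/
def firstDart {E : Type} (m : E → ℕ) (x : E × Bool) : (Σ e, Fin (m e + 1)) × Bool :=
  (⟨x.1, cond x.2 0 (Fin.last _)⟩, x.2)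

/-- The extension of a rotation to the subdivision: the two darts at a new vertex are exchanged. -/
def subdivideRot {E : Type} (m : E → ℕ) (σ : E × Bool → E × Bool) :
    (Σ e, Fin (m e + 1)) × Bool → (Σ e, Fin (m e + 1)) × Bool
  | (⟨e, i⟩, true) => Fin.cases (firstDart m (σ (e, true))) (fun q => (⟨e, q.castSucc⟩, false)) i
  | (⟨e, i⟩, false) => Fin.lastCases (firstDart m (σ (e, false))) (fun q => (⟨e, q.succ⟩, true)) i

section

variable {E : Type} (m : E → ℕ) (σ : E × Bool → E × Bool)

@[simp]
theorem subdivideRot_zero (e : E) :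
    subdivideRot m σ (⟨e, 0⟩, true) = firstDart m (σ (e, true)) := rfl

@[simp]
theorem subdivideRot_succ (e : E) (q : Fin (m e)) :
    subdivideRot m σ (⟨e, q.succ⟩, true) = (⟨e, q.castSucc⟩, false) := rfl

@[simp]
theorem subdivideRot_last (e : E) :
    subdivideRot m σ (⟨e, Fin.last _⟩, false) = firstDart m (σ (e, false)) := by
  simp [subdivideRot]

@[simp]
theorem subdivideRot_castSucc (e : E) (q : Fin (m e)) :
    subdivideRot m σ (⟨e, q.castSucc⟩, false) = (⟨e, q.succ⟩, true) := by
  simp [subdivideRot]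

@[simp]
theorem subdivideRot_firstDart (x : E × Bool) :
    subdivideRot m σ (firstDart m x) = firstDart m (σ x) := by
  obtain ⟨e, _ | _⟩ := x
  · exact subdivideRot_last m σ e
  · exact subdivideRot_zero m σ e

theorem dart_cases {P : (Σ e, Fin (m e + 1)) × Bool → Prop} (h : ∀ x, P (firstDart m x))
    (h1 : ∀ e (q : Fin (m e)), P (⟨e, q.succ⟩, true))
    (h2 : ∀ e (q : Fin (m e)), P (⟨e, q.castSucc⟩, false)) (x : (Σ e, Fin (m e + 1)) × Bool) :
    P x := by
  obtain ⟨⟨e, i⟩, _ | _⟩ := x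
  · induction i using Fin.lastCases with
    | last => exact h (e, false)
    | cast q => exact h2 e q
  · induction i using Fin.cases with
    | zero => exact h (e, true)
    | succ q => exact h1 e q

theorem subdivideRot_subdivideRot {σ τ : E × Bool → E × Bool} (h : ∀ x, σ (τ x) = x)
    (x : (Σ e, Fin (m e + 1)) × Bool) : subdivideRot m σ (subdivideRot m τ x) = x := by
  induction x using dart_cases with
  | h x => simp [h]
  | h1 e q => simp
  | h2 e q => simp

end

variable (R : RotationSystem) (m : R.E → ℕ)

/-- The vertex that a dart of the subdivision leaves. -/
def subdivideVert : (Σ e, Fin (m e + 1)) × Bool → R.V ⊕ (Σ e, Fin (m e))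
  | (⟨e, i⟩, true) => Fin.cases (Sum.inl (R.vert (e, true))) (fun q => Sum.inr ⟨e, q⟩) i
  | (⟨e, i⟩, false) => Fin.lastCases (Sum.inl (R.vert (e, false))) (fun q => Sum.inr ⟨e, q⟩) i

@[simp]
theorem subdivideVert_firstDart (x : R.E × Bool) :
    R.subdivideVert m (firstDart m x) = Sum.inl (R.vert x) := by
  obtain ⟨e, _ | _⟩ := x <;> simp [firstDart, subdivideVert]

@[simp]
theorem subdivideVert_succ (e : R.E) (q : Fin (m e)) :
    R.subdivideVert m (⟨e, q.succ⟩, true) = Sum.inr ⟨e, q⟩ := rfl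

@[simp]
theorem subdivideVert_castSucc (e : R.E) (q : Fin (m e)) :
    R.subdivideVert m (⟨e, q.castSucc⟩, false) = Sum.inr ⟨e, q⟩ := by
  simp [subdivideVert]

/-- The rotation system in which every edge `e` is replaced by a path with `m e` new vertices. -/
def subdivide : RotationSystem where
  V := R.V ⊕ (Σ e, Fin (m e))
  E := Σ e, Fin (m e + 1)
  finV := haveI := R.finV; haveI := R.finE; inferInstance
  finE := haveI := R.finE; inferInstance
  rot :=
    { toFun := subdivideRot m R.rot
      invFun := subdivideRot m R.rot.symm
      left_inv := subdivideRot_subdivideRot m R.rot.symm_apply_apply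
      right_inv := subdivideRot_subdivideRot m R.rot.apply_symm_apply }
  vert := R.subdivideVert m
  vert_surjective := by
    rintro (v | ⟨e, q⟩)
    · obtain ⟨x, rfl⟩ := R.vert_surjective v
      exact ⟨_, R.subdivideVert_firstDart m x⟩
    · exact ⟨(⟨e, q.succ⟩, true), rfl⟩
  vert_eq_iff x y := by
    let rot : Equiv.Perm ((Σ e, Fin (m e + 1)) × Bool) :=
      { toFun := subdivideRot m R.rot
        invFun := subdivideRot m R.rot.symm
        left_inv := subdivideRot_subdivideRot m R.rot.symm_apply_apply
        right_inv := subdivideRot_subdivideRot m R.rot.apply_symm_apply }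
    change _ ↔ rot.SameCycle x y
    let S : Setoid ((Σ e, Fin (m e + 1)) × Bool) :=
      ⟨rot.SameCycle, Equiv.Perm.SameCycle.equivalence _⟩
    have hstep : ∀ x, S x (rot x) := fun x => ⟨1, rfl⟩
    have hswap : ∀ e (q : Fin (m e)), S (⟨e, q.succ⟩, true) (⟨e, q.castSucc⟩, false) := fun e q =>
      hstep (⟨e, q.succ⟩, true)
    have hfirst : ∀ x y, R.vert x = R.vert y → S (firstDart m x) (firstDart m y) := by
      intro x y h
      refine ((R.vert_eq_iff x y).1 h).setoid_rel (S.comap (firstDart m)) fun x => ?_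
      have := hstep (firstDart m x)
      rwa [show rot (firstDart m x) = _ from subdivideRot_firstDart m R.rot x] at this
    constructor
    · intro h
      change S x y
      induction x using dart_cases with
      | h x =>
        induction y using dart_cases with
        | h y => exact hfirst x y (by simpa using h)
        | h1 e q => simp at h
        | h2 e q => simp at h
      | h1 e q =>
        induction y using dart_cases with
        | h y => simp at h
        | h1 e' q' =>
          have h' : (⟨e, q⟩ : Σ e, Fin (m e)) = ⟨e', q'⟩ := Sum.inr.inj h
          cases h'
          exact S.refl _
        | h2 e' q' =>
          have h' : (⟨e, q⟩ : Σ e, Fin (m e)) = ⟨e', q'⟩ :=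
            Sum.inr.inj (h.trans (R.subdivideVert_castSucc m e' q'))
          cases h'
          exact hswap e q
      | h2 e q =>
        rw [subdivideVert_castSucc] at h
        induction y using dart_cases with
        | h y => simp at h
        | h1 e' q' =>
          have h' : (⟨e, q⟩ : Σ e, Fin (m e)) = ⟨e', q'⟩ := Sum.inr.inj h
          cases h'
          exact S.symm (hswap e q)
        | h2 e' q' =>
          have h' : (⟨e, q⟩ : Σ e, Fin (m e)) = ⟨e', q'⟩ :=
            Sum.inr.inj (h.trans (R.subdivideVert_castSucc m e' q'))
          cases h'
          exact S.refl _
    · intro h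
      refine h.apply_eq (R.subdivideVert m) fun x => ?_
      show R.subdivideVert m (subdivideRot m R.rot x) = _
      induction x using dart_cases with
      | h x =>
        simp only [subdivideRot_firstDart, subdivideVert_firstDart, Sum.inl.injEq]
        exact (R.vert_eq_iff _ _).2
          (Equiv.Perm.sameCycle_apply_left.2 (Equiv.Perm.SameCycle.refl _ _))
      | h1 e q => simp
      | h2 e q => simp

variable {R} in
theorem Connected.subdivide (h : R.Connected) : (R.subdivide m).Connected := by
  obtain ⟨x₀, h⟩ := h
  refine ⟨firstDart m x₀, fun (P : (Σ e, Fin (m e + 1)) × Bool → Prop) h0 hrot hrev => ?_⟩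
  replace hrot : ∀ x, P x ↔ P (subdivideRot m R.rot x) := hrot
  have hup : ∀ e (i : Fin (m e + 1)), P (⟨e, i⟩, true) ↔ P (firstDart m (e, true)) := by
    intro e i
    induction i using Fin.induction with
    | zero => exact Iff.rfl
    | succ q ih =>
      rw [← ih, hrot (⟨e, q.succ⟩, true), subdivideRot_succ]
      exact hrev _
  have hdown : ∀ e (i : Fin (m e + 1)), P (⟨e, i⟩, false) ↔ P (firstDart m (e, true)) := by
    intro e i
    rw [← hup e i]
    exact hrev _
  have hall : ∀ x, P (firstDart m x) := by
    refine h _ h0 (fun x => ?_) fun x => ?_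
    · rw [hrot (firstDart m x), subdivideRot_firstDart]
    · obtain ⟨e, _ | _⟩ := x
      · exact hdown e _
      · exact (hdown e _).symm
  rintro ⟨⟨e, i⟩, _ | _⟩
  · exact (hdown e i).2 (hall _)
  · exact (hup e i).2 (hall _)

variable {R} in
theorem IsFaceMap.subdivide {T : Type} {F : R.E × Bool → T} (hF : R.IsFaceMap F) :
    (R.subdivide m).IsFaceMap fun x : (Σ e, Fin (m e + 1)) × Bool => F (x.1.1, x.2) := by
  let S : Setoid ((Σ e, Fin (m e + 1)) × Bool) :=
    ⟨(R.subdivide m).face.SameCycle, Equiv.Perm.SameCycle.equivalence _⟩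
  have hstep : ∀ x y, (R.subdivide m).face x = y → S x y := fun x y h => ⟨1, h⟩
  have hup : ∀ e (q : Fin (m e)), (R.subdivide m).face (⟨e, q.castSucc⟩, true) =
      (⟨e, q.succ⟩, true) := fun e q => subdivideRot_castSucc m R.rot e q
  have hdown : ∀ e (q : Fin (m e)), (R.subdivide m).face (⟨e, q.succ⟩, false) =
      (⟨e, q.castSucc⟩, false) := fun e q => subdivideRot_succ m R.rot e q
  have hlast : ∀ e, (R.subdivide m).face (⟨e, Fin.last _⟩, true) =
      firstDart m (R.face (e, true)) := fun e => subdivideRot_last m R.rot e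
  have hzero : ∀ e, (R.subdivide m).face (⟨e, 0⟩, false) =
      firstDart m (R.face (e, false)) := fun e => subdivideRot_zero m R.rot e
  have hfirst : ∀ e d (i : Fin (m e + 1)), S (firstDart m (e, d)) (⟨e, i⟩, d) := by
    intro e d i
    cases d
    · induction i using Fin.reverseInduction with
      | last => exact S.refl _
      | cast q ih => exact S.trans ih (hstep _ _ (hdown e q))
    · induction i using Fin.induction with
      | zero => exact S.refl _
      | succ q ih => exact S.trans ih (hstep _ _ (hup e q))
  constructor
  · intro t
    obtain ⟨⟨e, d⟩, rfl⟩ := hF.surjective t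
    exact ⟨(⟨e, 0⟩, d), rfl⟩
  · rintro ⟨⟨e, i⟩, d⟩ ⟨⟨e', i'⟩, d'⟩
    constructor
    · intro h
      have h1 : S (firstDart m (e, d)) (firstDart m (e', d')) := by
        refine ((hF.eq_iff _ _).1 h).setoid_rel (S.comap (firstDart m)) ?_
        rintro ⟨e, _ | _⟩
        · exact S.trans (hfirst e false 0) (hstep _ _ (hzero e))
        · exact S.trans (hfirst e true (Fin.last _)) (hstep _ _ (hlast e))
      exact S.trans (S.symm (hfirst e d i)) (S.trans h1 (hfirst e' d' i'))
    · intro h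
      have hface : ∀ x, F (R.face x) = F x := fun x =>
        (hF.eq_iff _ _).2 (Equiv.Perm.sameCycle_apply_left.2 (Equiv.Perm.SameCycle.refl _ _))
      let G : (Σ e, Fin (m e + 1)) × Bool → T := fun x => F (x.1.1, x.2)
      refine h.apply_eq G ?_
      rintro ⟨⟨e, i⟩, _ | _⟩
      · induction i using Fin.cases with
        | zero => exact (congrArg G (hzero e)).trans (hface (e, false))
        | succ q => exact (congrArg G (hdown e q)).trans rfl
      · induction i using Fin.lastCases with
        | last => exact (congrArg G (hlast e)).trans (hface (e, true))
        | cast q => exact (congrArg G (hup e q)).trans rfl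

theorem card_subdivide_V_add :
    Nat.card (R.subdivide m).V + Nat.card R.E = Nat.card R.V + Nat.card (R.subdivide m).E := by
  have := R.finE
  have := R.finV
  have := Fintype.ofFinite R.E
  have h1 : Nat.card (R.subdivide m).V = Nat.card R.V + ∑ e, m e := by
    show Nat.card (R.V ⊕ (Σ e, Fin (m e))) = _
    simp [Nat.card_sum]
  have h2 : Nat.card (R.subdivide m).E = ∑ e, m e + Nat.card R.E := by
    show Nat.card (Σ e, Fin (m e + 1)) = _
    simp [Finset.sum_add_distrib]
  omega

variable {R} in
theorem Connected.isPlane_subdivide (h : R.Connected) {T : Type} {F : R.E × Bool → T}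
    (hF : R.IsFaceMap F) (hcard : Nat.card R.V + Nat.card T = Nat.card R.E + 2) :
    (R.subdivide m).toCMap.IsPlane := by
  refine (h.subdivide m).isPlane (hF.subdivide m) ?_
  have := R.card_subdivide_V_add m
  omega

/-! ### Colourings of subdivisions -/

/-- `d` is the difference of the ends of a walk of length `l` in the cycle of length `N`. -/
def IsWalkDiff (N l : ℕ) (d : ZMod N) : Prop :=
  ∃ s : ℤ, d = s ∧ |s| ≤ l ∧ s % 2 = (l : ℤ) % 2

theorem isWalkDiff_one {N : ℕ} {d : ZMod N} : IsWalkDiff N 1 d ↔ d = 1 ∨ d = -1 := by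
  constructor
  · rintro ⟨s, rfl, hs1, hs2⟩
    rw [abs_le] at hs1
    push_cast at hs1 hs2
    rcases (by omega : s = 1 ∨ s = -1) with rfl | rfl <;> simp
  · rintro (rfl | rfl)
    · exact ⟨1, by simp, by simp, by simp⟩
    · exact ⟨-1, by simp, by simp, by simp⟩

/-- A walk that is two steps shorter than the cycle can join any two distinct vertices. -/
theorem isWalkDiff_iff_ne_zero {k : ℕ} (hk : 1 ≤ k) {d : ZMod (2 * k + 1)} :
    IsWalkDiff (2 * k + 1) (2 * k - 2 + 1) d ↔ d ≠ 0 := by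
  have hl : ((2 * k - 2 + 1 : ℕ) : ℤ) = 2 * k - 1 := by omega
  constructor
  · rintro ⟨s, rfl, hs1, hs2⟩ h
    rw [ZMod.intCast_zmod_eq_zero_iff_dvd] at h
    rw [hl] at hs1 hs2
    have hs0 : s ≠ 0 := by omega
    have := Int.le_of_dvd (abs_pos.2 hs0) ((dvd_abs _ _).2 h)
    push_cast at this
    omega
  · intro hd
    have h1 := ZMod.val_lt d
    have h2 : d.val ≠ 0 := (ZMod.val_ne_zero d).2 hd
    by_cases hodd : d.val % 2 = 1
    · refine ⟨d.val, by simp, ?_, ?_⟩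
      · rw [hl, abs_le]
        omega
      · omega
    · refine ⟨d.val - (2 * k + 1 : ℕ), ?_, ?_, ?_⟩
      · rw [Int.cast_sub, Int.cast_natCast, Int.cast_natCast, ZMod.natCast_self, sub_zero,
          ZMod.natCast_zmod_val]
      · rw [hl, abs_le]
        push_cast
        omega
      · push_cast
        omega

theorem IsWalkDiff.exists_walk {N l : ℕ} {a b : ZMod N} (h : IsWalkDiff N l (b - a)) :
    ∃ g : ℕ → ZMod N, g 0 = a ∧ g l = b ∧ ∀ i, g (i + 1) - g i = 1 ∨ g (i + 1) - g i = -1 := by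
  obtain ⟨s, hs, hs1, hs2⟩ := h
  rw [abs_le] at hs1
  -- The walk takes all its `u` steps up before its steps down.
  obtain ⟨u, hu⟩ : ∃ u : ℕ, (2 * u : ℤ) = l + s := ⟨((l + s) / 2).toNat, by omega⟩
  refine ⟨fun i => a + ((if i ≤ u then (i : ℤ) else 2 * u - i : ℤ) : ZMod N), by simp, ?_,
    fun i => ?_⟩
  · have : (if l ≤ u then (l : ℤ) else 2 * u - l : ℤ) = s := by
      split_ifs <;> omega
    show a + ((if l ≤ u then (l : ℤ) else 2 * u - l : ℤ) : ZMod N) = b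
    rw [this, ← hs]
    ring
  · beta_reduce
    by_cases h1 : i + 1 ≤ u
    · left
      rw [if_pos h1, if_pos (by omega)]
      push_cast
      ring
    · right
      by_cases h2 : i ≤ u
      · obtain rfl : i = u := by omega
        rw [if_neg h1, if_pos le_rfl]
        push_cast
        ring
      · rw [if_neg h1, if_neg h2]
        push_cast
        ring

/-- A colouring of a subdivision amounts to a colouring of the original vertices together with a
walk in the cycle of colours for every original edge. -/
theorem hasColoring_subdivide {N : ℕ} (S : Set (Σ e, Fin (m e + 1))) (f : R.V → ZMod N)
    (g : R.E → ℕ → ZMod N) (hg0 : ∀ e, g e 0 = f (R.vert (e, true)))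
    (hg1 : ∀ e, g e (m e + 1) = f (R.vert (e, false)))
    (hg : ∀ e (i : Fin (m e + 1)), ⟨e, i⟩ ∈ S → g e (i + 1) - g e i = 1 ∨
      g e (i + 1) - g e i = -1) :
    (R.subdivide m).toCMap.HasColoring N {c | c.1.1 ∈ S} := by
  let f' : R.V ⊕ (Σ e, Fin (m e)) → ZMod N := Sum.elim f fun q => g q.1 (q.2 + 1)
  have ht : ∀ e (i : Fin (m e + 1)), f' (R.subdivideVert m (⟨e, i⟩, true)) = g e i := by
    intro e i
    induction i using Fin.cases with
    | zero => exact (hg0 e).symm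
    | succ q => rw [subdivideVert_succ]; simp [f']
  have hf : ∀ e (i : Fin (m e + 1)), f' (R.subdivideVert m (⟨e, i⟩, false)) = g e (i + 1) := by
    intro e i
    induction i using Fin.lastCases with
    | last =>
      rw [show R.subdivideVert m (⟨e, Fin.last _⟩, false) = Sum.inl (R.vert (e, false)) from
        R.subdivideVert_firstDart m (e, false)]
      exact (hg1 e).symm
    | cast q => rw [subdivideVert_castSucc]; simp [f']
  refine ⟨f', ?_⟩
  rintro ⟨⟨⟨e, i⟩, _ | _⟩, s⟩ hc
  · change f' (R.subdivideVert m (⟨e, i⟩, true)) - f' (R.subdivideVert m (⟨e, i⟩, false)) = 1 ∨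
      f' (R.subdivideVert m (⟨e, i⟩, true)) - f' (R.subdivideVert m (⟨e, i⟩, false)) = -1
    rw [ht, hf, ← neg_sub, neg_eq_iff_eq_neg, neg_inj]
    exact (hg e i hc).symm
  · change f' (R.subdivideVert m (⟨e, i⟩, false)) - f' (R.subdivideVert m (⟨e, i⟩, true)) = 1 ∨
      f' (R.subdivideVert m (⟨e, i⟩, false)) - f' (R.subdivideVert m (⟨e, i⟩, true)) = -1
    rw [ht, hf]
    exact hg e i hc

/-- Conversely, a colouring of a subdivision gives a walk in the cycle of colours along every
original edge. -/
theorem exists_of_hasColoring_subdivide {N : ℕ}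
    (h : (R.subdivide m).toCMap.HasColoring N Set.univ) :
    ∃ f : R.V → ZMod N, ∀ e,
      IsWalkDiff N (m e + 1) (f (R.vert (e, false)) - f (R.vert (e, true))) := by
  obtain ⟨(f' : R.V ⊕ (Σ e, Fin (m e)) → ZMod N), hf'⟩ := h
  refine ⟨fun v => f' (Sum.inl v), fun e => ?_⟩
  show ∃ s : ℤ, f' (Sum.inl (R.vert (e, false))) - f' (Sum.inl (R.vert (e, true))) = s ∧ _
  have hstep : ∀ i : Fin (m e + 1), ∃ s : ℤ, (s = 1 ∨ s = -1) ∧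
      f' (R.subdivideVert m (⟨e, i⟩, false)) = f' (R.subdivideVert m (⟨e, i⟩, true)) + s := by
    intro i
    rcases hf' ((⟨e, i⟩, true), true) trivial with h | h
    · exact ⟨1, Or.inl rfl, by rw [← sub_eq_iff_eq_add']; push_cast; exact h⟩
    · exact ⟨-1, Or.inr rfl, by rw [← sub_eq_iff_eq_add']; push_cast; exact h⟩
  have key : ∀ i : Fin (m e + 1), ∃ s : ℤ, f' (R.subdivideVert m (⟨e, i⟩, true)) =
      f' (Sum.inl (R.vert (e, true))) + s ∧ |s| ≤ (i : ℕ) ∧ s % 2 = ((i : ℕ) : ℤ) % 2 := by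
    intro i
    induction i using Fin.induction with
    | zero => exact ⟨0, by simp [subdivideVert], by simp, by simp⟩
    | succ q ih =>
      obtain ⟨s, hs1, hs2, hs3⟩ := ih
      obtain ⟨s', hs', hs4⟩ := hstep q.castSucc
      rw [subdivideVert_castSucc, hs1] at hs4
      rw [Fin.val_castSucc] at hs2 hs3
      refine ⟨s + s', by rw [subdivideVert_succ, hs4]; push_cast; ring, ?_, ?_⟩
      · rw [Fin.val_succ, abs_le] at *
        push_cast
        omega
      · rw [Fin.val_succ]
        push_cast
        omega
  obtain ⟨s, hs1, hs2, hs3⟩ := key (Fin.last _)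
  obtain ⟨s', hs', hs4⟩ := hstep (Fin.last _)
  rw [show R.subdivideVert m (⟨e, Fin.last _⟩, false) = Sum.inl (R.vert (e, false)) from
    R.subdivideVert_firstDart m (e, false), hs1] at hs4
  rw [Fin.val_last] at hs2 hs3
  refine ⟨s + s', by rw [hs4]; push_cast; ring, ?_, by push_cast; omega⟩
  rw [abs_le] at *
  push_cast
  omega

/-- If the original vertices have colours that extend to all original edges but one, then the
subdivision can be coloured after the deletion of any edge on the path that replaces this edge. -/
theorem hasColoring_subdivide_of_forall_ne {N : ℕ} (f : R.V → ZMod N) (e₀ : R.E)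
    (h : ∀ e, e ≠ e₀ → IsWalkDiff N (m e + 1) (f (R.vert (e, false)) - f (R.vert (e, true))))
    (i₀ : Fin (m e₀ + 1)) :
    (R.subdivide m).toCMap.HasColoring N {c | c.1.1 ≠ ⟨e₀, i₀⟩} := by
  have hwalk : ∀ e, ∃ g : ℕ → ZMod N, g 0 = f (R.vert (e, true)) ∧
      g (m e + 1) = f (R.vert (e, false)) ∧ ∀ i : Fin (m e + 1),
        (⟨e, i⟩ : Σ e, Fin (m e + 1)) ≠ ⟨e₀, i₀⟩ →
          g (i + 1) - g i = 1 ∨ g (i + 1) - g i = -1 := by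
    intro e
    by_cases he : e = e₀
    · subst he
      -- Walk away from each of the two ends up to the deleted edge.
      refine ⟨fun p => if p ≤ i₀ then f (R.vert (e, true)) + p else
        f (R.vert (e, false)) + ((m e + 1 : ℕ) - p), by simp, ?_, fun i hi => ?_⟩
      · show (if _ then _ else _) = _
        rw [if_neg (by omega)]
        ring
      · have hne : (i : ℕ) ≠ i₀ := fun h => hi (by rw [Fin.ext h])
        show (if _ then _ else _) - (if _ then _ else _) = _ ∨
          (if _ then _ else _) - (if _ then _ else _) = _
        by_cases h1 : (i : ℕ) < i₀
        · left
          rw [if_pos (by omega), if_pos (by omega)]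
          push_cast
          ring
        · right
          rw [if_neg (by omega), if_neg (by omega)]
          push_cast
          ring
    · obtain ⟨g, hg0, hg1, hg⟩ := (h e he).exists_walk
      exact ⟨g, hg0, hg1, fun i _ => hg i⟩
  choose g hg0 hg1 hg using hwalk
  exact R.hasColoring_subdivide m {q | q ≠ ⟨e₀, i₀⟩} f g hg0 hg1 hg

end RotationSystem

/-! ### Wheels with a possibly split hub -/

namespace RotationSystem

section Wheel

variable {I H : Type} (s τ : Equiv.Perm I)

/-- The rotation of a wheel whose rim vertices are permuted cyclically by `s`.  The spoke
`Sum.inl i` leads from a hub to the rim vertex `i`, the rim edge `Sum.inr i` leads from `i` to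
`s i`.  The spokes are rotated in such a way that the walk along an inner face goes from the rim
edge `Sum.inr i` by way of a hub to the rim edge `Sum.inr (τ i)`. -/
def wheelRot : Equiv.Perm ((I ⊕ I) × Bool) where
  toFun
    | (Sum.inl i, true) => (Sum.inl (τ (s.symm i)), true)
    | (Sum.inl i, false) => (Sum.inr i, true)
    | (Sum.inr i, true) => (Sum.inr (s.symm i), false)
    | (Sum.inr i, false) => (Sum.inl (s i), false)
  invFun
    | (Sum.inl i, true) => (Sum.inl (s (τ.symm i)), true)
    | (Sum.inl i, false) => (Sum.inr (s.symm i), false)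
    | (Sum.inr i, true) => (Sum.inl i, false)
    | (Sum.inr i, false) => (Sum.inr (s i), true)
  left_inv := by rintro ⟨i | i, _ | _⟩ <;> simp
  right_inv := by rintro ⟨i | i, _ | _⟩ <;> simp

@[simp]
theorem wheelRot_inr_true (i : I) :
    wheelRot s τ (Sum.inr i, true) = (Sum.inr (s.symm i), false) := rfl

/-- The vertex that a dart of a wheel leaves, where `hub i` is the hub at the spoke `i`. -/
def wheelVert (hub : I → H) : (I ⊕ I) × Bool → H ⊕ I
  | (Sum.inl i, true) => Sum.inl (hub i)
  | (Sum.inl i, false) => Sum.inr i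
  | (Sum.inr i, true) => Sum.inr i
  | (Sum.inr i, false) => Sum.inr (s i)

/-- The rotation of the spokes. -/
def spokeRot : Equiv.Perm I := s.symm.trans τ

variable [Finite I] [Finite H] (hub : I → H) (hsurj : Function.Surjective hub)
  (hhub : ∀ i j, hub i = hub j ↔ (spokeRot s τ).SameCycle i j)

/-- The wheel with rim permutation `s`, inner face permutation `τ` and hubs `H`. -/
def wheel : RotationSystem where
  V := H ⊕ I
  E := I ⊕ I
  finV := inferInstance
  finE := inferInstance
  rot := wheelRot s τ
  vert := wheelVert s hub
  vert_surjective := by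
    rintro (h | i)
    · obtain ⟨i, rfl⟩ := hsurj h
      exact ⟨(Sum.inl i, true), rfl⟩
    · exact ⟨(Sum.inr i, true), rfl⟩
  vert_eq_iff x y := by
    let S : Setoid ((I ⊕ I) × Bool) :=
      ⟨(wheelRot s τ).SameCycle, Equiv.Perm.SameCycle.equivalence _⟩
    have hstep : ∀ x, S x (wheelRot s τ x) := fun x => ⟨1, rfl⟩
    constructor
    · intro h
      change S x y
      have hrim : ∀ x i, wheelVert s hub x = Sum.inr i → S (Sum.inr i, true) x := by
        rintro ⟨i | i, _ | _⟩ i' h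
        · obtain rfl := Sum.inr.inj h
          exact S.symm (hstep (Sum.inl i, false))
        · cases h
        · obtain rfl := Sum.inr.inj h
          simpa using hstep (Sum.inr (s i), true)
        · obtain rfl := Sum.inr.inj h
          exact S.refl _
      rcases hx : wheelVert s hub x with v | i
      · rw [hx] at h
        obtain ⟨i | i, _ | _⟩ := x <;> obtain ⟨i' | i', _ | _⟩ := y <;>
          simp [wheelVert] at hx h
        refine ((hhub i i').1 (hx.trans h)).setoid_rel
          (S.comap fun i => (Sum.inl i, true)) fun i => ?_
        exact hstep (Sum.inl i, true)
      · exact S.trans (S.symm (hrim x i hx)) (hrim y i (h.symm.trans hx))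
    · intro h
      refine h.apply_eq (wheelVert s hub) ?_
      rintro ⟨i | i, _ | _⟩
      · rfl
      · exact congrArg Sum.inl ((hhub _ _).2 (Equiv.Perm.SameCycle.symm ⟨1, rfl⟩))
      · rfl
      · simp [wheelVert]

variable {s} in
theorem wheel_connected (hs : ∀ i j, s.SameCycle i j) (i₀ : I) :
    (wheel s τ hub hsurj hhub).Connected := by
  refine ⟨(Sum.inr i₀, true), fun (P : (I ⊕ I) × Bool → Prop) h0 hrot hrev => ?_⟩
  replace hrot : ∀ x, P x ↔ P (wheelRot s τ x) := hrot
  have hrim : ∀ i, P (Sum.inr i, true) := by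
    intro i
    have := (hs i₀ i).apply_eq (fun i => P (Sum.inr i, true)) fun i => propext <| by
      rw [hrot, wheelRot_inr_true, s.symm_apply_apply]
      exact hrev _
    exact this.mp h0
  have hspoke : ∀ i, P (Sum.inl i, false) := fun i => (hrot _).2 (hrim i)
  rintro ⟨i | i, _ | _⟩
  · exact hspoke i
  · exact (hrev (Sum.inl i, true)).2 (hspoke i)
  · exact (hrev (Sum.inr i, false)).2 (hrim i)
  · exact hrim i

/-- The face to the left of a dart of a wheel: `none` is the face outside of the rim, and
`some (cls i)` is the face inside the rim edge `i`. -/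
def wheelFace {T : Type} (cls : I → T) : (I ⊕ I) × Bool → Option T
  | (Sum.inl i, true) => some (cls i)
  | (Sum.inl i, false) => some (cls (s.symm i))
  | (Sum.inr i, true) => some (cls i)
  | (Sum.inr _, false) => none

variable {s} in
theorem wheel_isFaceMap (hs : ∀ i j, s.SameCycle i j) (i₀ : I) {T : Type} (cls : I → T)
    (hcls : Function.Surjective cls) (hτ : ∀ i j, cls i = cls j ↔ τ.SameCycle i j) :
    (wheel s τ hub hsurj hhub).IsFaceMap (wheelFace s cls) := by
  let φ : Equiv.Perm ((I ⊕ I) × Bool) := (wheel s τ hub hsurj hhub).face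
  let S : Setoid ((I ⊕ I) × Bool) := ⟨φ.SameCycle, Equiv.Perm.SameCycle.equivalence _⟩
  have hstep : ∀ x, S x (φ x) := fun x => ⟨1, rfl⟩
  have h1 : ∀ i, S (Sum.inl i, true) (Sum.inr i, true) := fun i => hstep (Sum.inl i, true)
  have h2 : ∀ i, S (Sum.inr i, true) (Sum.inl (s i), false) := fun i => hstep (Sum.inr i, true)
  have h3 : ∀ i, S (Sum.inl i, false) (Sum.inl (τ (s.symm i)), true) := fun i =>
    hstep (Sum.inl i, false)
  have hinner : ∀ i j, cls i = cls j → S (Sum.inr i, true) (Sum.inr j, true) := by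
    intro i j h
    refine ((hτ i j).1 h).setoid_rel (S.comap fun i => (Sum.inr i, true)) fun i => ?_
    have := h3 (s i)
    rw [s.symm_apply_apply] at this
    exact S.trans (h2 i) (S.trans this (h1 _))
  have hrim : ∀ x i, wheelFace s cls x = some (cls i) → S x (Sum.inr i, true) := by
    rintro ⟨i | i, _ | _⟩ i' h
    · refine S.trans (S.symm ?_) (hinner (s.symm i) i' (Option.some.inj h))
      simpa using h2 (s.symm i)
    · exact S.trans (h1 i) (hinner i i' (Option.some.inj h))
    · cases h
    · exact hinner i i' (Option.some.inj h)
  have houter : ∀ x, wheelFace s cls x = none → S x (Sum.inr i₀, false) := by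
    rintro ⟨i | i, _ | _⟩ h
    · cases h
    · cases h
    · refine (hs i i₀).setoid_rel (S.comap fun i => (Sum.inr i, false)) fun i => S.symm ?_
      have := hstep (Sum.inr (s i), false)
      rwa [show φ (Sum.inr (s i), false) = (Sum.inr (s.symm (s i)), false) from rfl,
        s.symm_apply_apply] at this
    · cases h
  constructor
  · rintro (_ | t)
    · exact ⟨(Sum.inr i₀, false), rfl⟩
    · obtain ⟨i, rfl⟩ := hcls t
      exact ⟨(Sum.inr i, true), rfl⟩
  · intro x y
    constructor
    · intro h
      change S x y
      rcases hx : wheelFace s cls x with _ | t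
      · exact S.trans (houter x hx) (S.symm (houter y (h.symm.trans hx)))
      · obtain ⟨i, rfl⟩ := hcls t
        exact S.trans (hrim x i hx) (S.symm (hrim y i (h.symm.trans hx)))
    · intro h
      refine h.apply_eq (wheelFace s cls) ?_
      have hτ1 : ∀ i, cls (τ i) = cls i := fun i =>
        (hτ _ _).2 (Equiv.Perm.SameCycle.symm ⟨1, rfl⟩)
      rintro ⟨i | i, _ | _⟩
      · exact congrArg some (hτ1 _)
      · rfl
      · rfl
      · exact congrArg (fun i => some (cls i)) (s.symm_apply_apply i)

end Wheel

end RotationSystem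

/-! ### The rim of the wheels -/

/-- Rim vertices: there are `m` blocks, each of them with three consecutive rim vertices. -/
abbrev Rim (m : ℕ) : Type := ZMod m × Fin 3

namespace Rim

variable {m : ℕ}

/-- The cyclic order of the rim vertices. -/
def next (m : ℕ) : Equiv.Perm (Rim m) where
  toFun i := if i.2 = 2 then (i.1 + 1, 0) else (i.1, i.2 + 1)
  invFun i := if i.2 = 0 then (i.1 - 1, 2) else (i.1, i.2 - 1)
  left_inv := by
    rintro ⟨t, κ⟩
    fin_cases κ <;> simp
  right_inv := by
    rintro ⟨t, κ⟩
    fin_cases κ <;> simp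

@[simp]
theorem next_one (t : ZMod m) : next m (t, 1) = (t, 2) := rfl

/-- The rim vertex at position `p`. -/
def nth (m p : ℕ) : Rim m := (((p / 3 : ℕ) : ZMod m), ⟨p % 3, Nat.mod_lt _ (by norm_num)⟩)

theorem nth_three_mul_add (q : ℕ) (κ : Fin 3) : nth m (3 * q + κ) = ((q : ZMod m), κ) := by
  simp only [nth]
  rw [show (3 * q + κ) / 3 = q by omega]
  congr 1
  exact Fin.ext (show (3 * q + κ) % 3 = κ by omega)

theorem next_nth (p : ℕ) : next m (nth m p) = nth m (p + 1) := by
  obtain ⟨q, rfl | rfl | rfl⟩ : ∃ q, p = 3 * q ∨ p = 3 * q + 1 ∨ p = 3 * q + 2 :=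
    ⟨p / 3, by omega⟩
  · exact (congrArg _ (nth_three_mul_add q 0)).trans (nth_three_mul_add q 1).symm
  · exact (congrArg _ (nth_three_mul_add q 1)).trans (nth_three_mul_add q 2).symm
  · have h := nth_three_mul_add (m := m) (q + 1) 0
    rw [Nat.cast_succ] at h
    exact (congrArg _ (nth_three_mul_add q 2)).trans h.symm

/-- The position of a rim vertex. -/
def pos (i : Rim m) : ℕ := 3 * i.1.val + i.2

theorem pos_lt [NeZero m] (i : Rim m) : pos i < 3 * m := by
  have := ZMod.val_lt i.1
  have := i.2.2
  simp only [pos]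
  omega

@[simp]
theorem nth_pos [NeZero m] (i : Rim m) : nth m (pos i) = i := by
  obtain ⟨t, κ⟩ := i
  have h1 : (3 * t.val + κ) / 3 = t.val := by omega
  have h2 : (3 * t.val + κ) % 3 = κ := by omega
  refine Prod.ext ?_ (Fin.ext h2)
  show (((3 * t.val + κ) / 3 : ℕ) : ZMod m) = t
  rw [h1, ZMod.natCast_zmod_val]

theorem pos_nth {p : ℕ} (hp : p < 3 * m) : pos (nth m p) = p := by
  simp only [pos, nth]
  rw [ZMod.val_cast_of_lt (by omega)]
  omega

theorem pos_injective [NeZero m] : Function.Injective (pos (m := m)) := fun i j h => by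
  rw [← nth_pos i, ← nth_pos j, h]

theorem card_rim : Nat.card (Rim m) = 3 * m := by
  rw [Nat.card_prod, Nat.card_zmod, Nat.card_fin, mul_comm]

theorem sameCycle_next [NeZero m] (i j : Rim m) : (next m).SameCycle i j := by
  have : ∀ p, (next m).SameCycle (nth m 0) (nth m p) := by
    intro p
    induction p with
    | zero => exact Equiv.Perm.SameCycle.refl _ _
    | succ p ih => rwa [← next_nth, Equiv.Perm.sameCycle_apply_right]
  rw [← nth_pos i, ← nth_pos j]
  exact (this _).symm.trans (this _)

/-! ### The wheel and its split wheels -/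

/-- The single hub of the whole wheel. -/
theorem hub_unit [NeZero m] (i j : Rim m) :
    (fun _ : Rim m => ()) i = (fun _ => ()) j ↔
      (RotationSystem.spokeRot (next m) 1).SameCycle i j := by
  simp only [true_iff]
  exact (Equiv.Perm.sameCycle_inv (f := next m)).2 (sameCycle_next i j)

/-- The hub of a spoke after the hub has been split: the spokes from position `0` to position `3 j`
are at the hub `true`, all others at the hub `false`. -/
def hub (j : ℕ) (i : Rim m) : Bool := decide (pos i ≤ 3 * j)

/-- After the hub has been split, the face inside the rim edge at position `3 j` is the one inside
the last rim edge. -/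
def split (m j : ℕ) : Equiv.Perm (Rim m) := Equiv.swap (nth m (3 * j)) (nth m (3 * m - 1))

theorem split_nth_of_ne [NeZero m] {j p : ℕ} (hj : j < m) (hp : p < 3 * m) (h1 : p ≠ 3 * j)
    (h2 : p ≠ 3 * m - 1) : split m j (nth m p) = nth m p := by
  refine Equiv.swap_apply_of_ne_of_ne (fun h => h1 ?_) fun h => h2 ?_
  · rw [← pos_nth hp, h, pos_nth (by omega)]
  · rw [← pos_nth hp, h, pos_nth (by omega)]

theorem nth_three_mul : nth m (3 * m) = nth m 0 := by
  simp [nth]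

theorem hub_split [NeZero m] {j : ℕ} (hj : j < m) (i : Rim m) :
    hub j (split m j i) = hub j (next m i) := by
  have hp := pos_lt i
  rw [← nth_pos i, next_nth]
  generalize pos i = p at hp
  by_cases h1 : p = 3 * j
  · subst h1
    rw [split, Equiv.swap_apply_left]
    simp only [hub]
    rw [pos_nth (by omega), pos_nth (by omega)]
    simp only [decide_eq_decide]
    omega
  · by_cases h2 : p = 3 * m - 1
    · subst h2
      rw [split, Equiv.swap_apply_right, Nat.sub_add_cancel (by omega), nth_three_mul]
      simp only [hub]
      rw [pos_nth (by omega), pos_nth (by omega)]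
      simp
    · rw [split_nth_of_ne hj hp h1 h2]
      simp only [hub]
      rw [pos_nth (by omega), pos_nth (by omega)]
      simp only [decide_eq_decide]
      omega

theorem hub_iff [NeZero m] {j : ℕ} (hj : j < m) (i i' : Rim m) :
    hub j i = hub j i' ↔ (RotationSystem.spokeRot (next m) (split m j)).SameCycle i i' := by
  let π : Equiv.Perm (Rim m) := RotationSystem.spokeRot (next m) (split m j)
  change _ ↔ π.SameCycle i i'
  have hπ : ∀ i, π (next m i) = split m j i := fun i => by
    simp [π, RotationSystem.spokeRot]
  have hadj : ∀ p, p < 3 * m → p ≠ 3 * j → p ≠ 3 * m - 1 →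
      π.SameCycle (nth m (p + 1)) (nth m p) := by
    intro p hp h1 h2
    refine ⟨1, ?_⟩
    rw [zpow_one, ← next_nth, hπ, split_nth_of_ne hj hp h1 h2]
  have hlow : ∀ p, p ≤ 3 * j → π.SameCycle (nth m p) (nth m 0) := by
    intro p hp
    induction p with
    | zero => exact Equiv.Perm.SameCycle.refl _ _
    | succ p ih => exact (hadj p (by omega) (by omega) (by omega)).trans (ih (by omega))
  have hhigh : ∀ p, 3 * j + 1 ≤ p → p < 3 * m → π.SameCycle (nth m p) (nth m (3 * j + 1)) := by
    intro p hp
    induction p, hp using Nat.le_induction with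
    | base => exact fun _ => Equiv.Perm.SameCycle.refl _ _
    | succ p hp ih =>
      intro hp'
      exact (hadj p (by omega) (by omega) (by omega)).trans (ih (by omega))
  constructor
  · intro h
    have hi := pos_lt i
    have hi' := pos_lt i'
    simp only [hub, decide_eq_decide] at h
    rw [← nth_pos i, ← nth_pos i']
    by_cases hp : pos i ≤ 3 * j
    · exact (hlow _ hp).trans (hlow _ (h.1 hp)).symm
    · exact (hhigh _ (by omega) hi).trans (hhigh _ (by omega) hi').symm
  · intro h
    refine h.apply_eq (hub j) fun i => ?_
    obtain ⟨i, rfl⟩ := (next m).surjective i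
    rw [hπ, hub_split hj]

theorem hub_surjective [NeZero m] {j : ℕ} (hj : j < m) : Function.Surjective (hub (m := m) j) := by
  rintro (_ | _)
  · refine ⟨nth m (3 * m - 1), ?_⟩
    rw [hub, pos_nth (by omega)]
    simp only [decide_eq_false_iff_not]
    omega
  · refine ⟨nth m 0, ?_⟩
    rw [hub, pos_nth (by omega)]
    simp

/-- The inner faces after the hub has been split. -/
def faceClass (m j : ℕ) (i : Rim m) : Rim m :=
  if i = nth m (3 * m - 1) then nth m (3 * j) else i

theorem faceClass_iff [NeZero m] {j : ℕ} (hj : j < m) (i i' : Rim m) :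
    faceClass m j i = faceClass m j i' ↔ (split m j).SameCycle i i' := by
  have hne : nth m (3 * j) ≠ nth m (3 * m - 1) := fun h => by
    have := congrArg pos h
    rw [pos_nth (by omega), pos_nth (by omega)] at this
    omega
  have hab : (split m j).SameCycle (nth m (3 * m - 1)) (nth m (3 * j)) :=
    ⟨1, by rw [zpow_one, split, Equiv.swap_apply_right]⟩
  have hcls : ∀ i, (split m j).SameCycle i (faceClass m j i) := by
    intro i
    unfold faceClass
    split_ifs with h
    · rwa [h]
    · exact Equiv.Perm.SameCycle.refl _ _
  constructor
  · intro h
    exact (hcls i).trans (h ▸ (hcls i').symm)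
  · intro h
    refine h.apply_eq (faceClass m j) fun i => ?_
    by_cases h1 : i = nth m (3 * j)
    · subst h1
      rw [split, Equiv.swap_apply_left, faceClass, faceClass, if_pos rfl, if_neg hne]
    · by_cases h2 : i = nth m (3 * m - 1)
      · subst h2
        rw [split, Equiv.swap_apply_right, faceClass, faceClass, if_pos rfl, if_neg hne]
      · rw [split, Equiv.swap_apply_of_ne_of_ne h1 h2]

theorem card_range_faceClass [NeZero m] {j : ℕ} (hj : j < m) :
    Nat.card (Set.range (faceClass m j)) + 1 = 3 * m := by
  have hne : nth m (3 * j) ≠ nth m (3 * m - 1) := fun h => by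
    have := congrArg pos h
    rw [pos_nth (by omega), pos_nth (by omega)] at this
    omega
  have : Set.range (faceClass m j) = {nth m (3 * m - 1)}ᶜ := by
    ext i
    rw [Set.mem_range, Set.mem_compl_iff, Set.mem_singleton_iff]
    constructor
    · rintro ⟨i', rfl⟩ h
      unfold faceClass at h
      split_ifs at h with h'
      · exact hne h
      · exact h' h
    · intro h
      exact ⟨i, if_neg h⟩
  have hcard := Set.ncard_add_ncard_compl {nth m (3 * m - 1)}
  rw [Set.ncard_singleton, card_rim] at hcard
  rw [this, Nat.card_coe_set_eq]
  omega

end Rim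

/-! ### Degrees -/

namespace RotationSystem

variable (R : RotationSystem)

/-- The degree of a vertex. -/
noncomputable def degree (v : R.V) : ℕ := (R.vert ⁻¹' {v}).ncard

theorem numCrosses_eq (v : R.V) : R.toCMap.numCrosses v = 2 * R.degree v := by
  show Nat.card {c : (R.E × Bool) × Bool // R.vert c.1 = v} = _
  have h : {c : (R.E × Bool) × Bool | R.vert c.1 = v} = (R.vert ⁻¹' {v}) ×ˢ Set.univ := by
    ext c
    simp
  rw [← Set.coe_ofPred, h, Nat.card_coe_set_eq, Set.ncard_prod, Set.ncard_univ, degree, mul_comm]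
  simp

theorem firstDart_injective {E : Type} (m : E → ℕ) : Function.Injective (firstDart m) := by
  rintro ⟨e, d⟩ ⟨e', d'⟩ h
  obtain ⟨h1, h2⟩ := Prod.mk.inj h
  exact Prod.ext (Sigma.mk.inj h1).1 h2

theorem degree_subdivide_inl (m : R.E → ℕ) (v : R.V) :
    (R.subdivide m).degree (Sum.inl v : R.V ⊕ (Σ e, Fin (m e))) = R.degree v := by
  have h : R.subdivideVert m ⁻¹' {Sum.inl v} = firstDart m '' (R.vert ⁻¹' {v}) := by
    ext x
    induction x using dart_cases with
    | h x => simp [(firstDart_injective m).eq_iff]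
    | h1 e q =>
      simp only [Set.mem_preimage, subdivideVert_succ, Set.mem_singleton_iff, reduceCtorEq,
        Set.mem_image, false_iff, not_exists, not_and]
      rintro x - hx
      have := congrArg (R.subdivideVert m) hx
      simp at this
    | h2 e q =>
      simp only [Set.mem_preimage, subdivideVert_castSucc, Set.mem_singleton_iff, reduceCtorEq,
        Set.mem_image, false_iff, not_exists, not_and]
      rintro x - hx
      have := congrArg (R.subdivideVert m) hx
      simp at this
  show (R.subdivideVert m ⁻¹' {Sum.inl v}).ncard = _
  rw [h, Set.ncard_image_of_injective _ (firstDart_injective m)]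
  rfl

theorem degree_subdivide_inr_le (m : R.E → ℕ) (q : Σ e, Fin (m e)) :
    (R.subdivide m).degree (Sum.inr q : R.V ⊕ (Σ e, Fin (m e))) ≤ 2 := by
  have h : R.subdivideVert m ⁻¹' {Sum.inr q} ⊆
      {(⟨q.1, q.2.succ⟩, true), (⟨q.1, q.2.castSucc⟩, false)} := by
    intro x hx
    induction x using dart_cases with
    | h x => simp at hx
    | h1 e q' =>
      have hx' : (⟨e, q'⟩ : Σ e, Fin (m e)) = q := Sum.inr.inj hx
      subst hx'
      simp
    | h2 e q' =>
      rw [Set.mem_preimage, subdivideVert_castSucc] at hx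
      have hx' : (⟨e, q'⟩ : Σ e, Fin (m e)) = q := Sum.inr.inj hx
      subst hx'
      simp
  exact (Set.ncard_le_ncard h).trans (Set.ncard_insert_le _ _ |>.trans (by simp))

section Wheel

variable {I H : Type} [Finite I] [Finite H] (s τ : Equiv.Perm I) (hub : I → H)
  (hsurj : Function.Surjective hub)
  (hhub : ∀ i j, hub i = hub j ↔ (spokeRot s τ).SameCycle i j)

theorem degree_wheel_hub (h : H) :
    (wheel s τ hub hsurj hhub).degree (Sum.inl h : H ⊕ I) = (hub ⁻¹' {h}).ncard := by
  have h : wheelVert s hub ⁻¹' {Sum.inl h} =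
      (fun i => (Sum.inl i, true)) '' (hub ⁻¹' {h}) := by
    ext x
    obtain ⟨i | i, _ | _⟩ := x <;> simp [wheelVert]
  show (wheelVert s hub ⁻¹' {Sum.inl _}).ncard = _
  rw [h, Set.ncard_image_of_injective]
  intro i j hij
  simpa using hij

theorem degree_wheel_rim_le (i : I) :
    (wheel s τ hub hsurj hhub).degree (Sum.inr i : H ⊕ I) ≤ 3 := by
  have h : wheelVert s hub ⁻¹' {Sum.inr i} ⊆
      {(Sum.inl i, false), (Sum.inr i, true), (Sum.inr (s.symm i), false)} := by
    rintro ⟨i' | i', _ | _⟩ hx <;> simp [wheelVert] at hx <;> simp [← hx]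
  refine (Set.ncard_le_ncard h).trans (Set.ncard_insert_le _ _ |>.trans ?_)
  exact Nat.succ_le_succ (Set.ncard_insert_le _ _ |>.trans (by simp))

end Wheel

end RotationSystem

namespace Rim

variable {m : ℕ} [NeZero m]

theorem ncard_hub_true {j : ℕ} (hj : j < m) : (hub (m := m) j ⁻¹' {true}).ncard = 3 * j + 1 := by
  have h : pos '' (hub (m := m) j ⁻¹' {true}) = Set.Iic (3 * j) := by
    ext p
    simp only [Set.mem_image, Set.mem_preimage, hub, Set.mem_singleton_iff, decide_eq_true_eq,
      Set.mem_Iic]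
    constructor
    · rintro ⟨i, hi, rfl⟩
      exact hi
    · intro hp
      have := pos_nth (m := m) (p := p) (by omega)
      exact ⟨nth m p, by omega, this⟩
  rw [← Set.ncard_image_of_injective _ pos_injective, h, ← Finset.coe_Iic, Set.ncard_coe_finset,
    Nat.card_Iic]

theorem ncard_hub_false {j : ℕ} (hj : j < m) :
    (hub (m := m) j ⁻¹' {false}).ncard + (3 * j + 1) = 3 * m := by
  rw [← ncard_hub_true hj, ← card_rim, add_comm]
  have h : hub (m := m) j ⁻¹' {false} = (hub (m := m) j ⁻¹' {true})ᶜ := by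
    ext i
    simp
  rw [h, Set.ncard_add_ncard_compl]

end Rim

/-! ### The maps of the antichain and their common image -/

open RotationSystem Rim

/-- The number of vertices that subdivide an edge of the wheel.  The spokes to the first vertices of
the blocks and the rim edges between the other two vertices of the blocks become paths of length
`2 k - 1`. -/
def newVerts (m k : ℕ) : Rim m ⊕ Rim m → ℕ
  | Sum.inl i => if i.2 = 0 then 2 * k - 2 else 0
  | Sum.inr i => if i.2 = 1 then 2 * k - 2 else 0

section

variable (m : ℕ) [NeZero m]

/-- The wheel with `3 m` spokes. -/
def wholeWheel : RotationSystem :=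
  wheel (next m) 1 (fun _ => ()) (fun _ => ⟨nth m 0, rfl⟩) hub_unit

/-- The wheel with `3 m` spokes whose hub has been split into hubs of degrees `3 j + 1` and
`3 (m - j) - 1`. -/
def splitWheel {j : ℕ} (hj : j < m) : RotationSystem :=
  wheel (next m) (split m j) (hub j) (hub_surjective hj) (hub_iff hj)

/-- The common image of the antichain. -/
def wholeMap (k : ℕ) : CMap := ((wholeWheel m).subdivide (newVerts m k)).toCMap

/-- The members of the antichain. -/
def splitMap (k : ℕ) {j : ℕ} (hj : j < m) : CMap :=
  ((splitWheel m hj).subdivide (newVerts m k)).toCMap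

end

section

variable {m : ℕ} [NeZero m] (k : ℕ)

theorem wholeWheel_connected : (wholeWheel m).Connected :=
  wheel_connected _ _ _ _ sameCycle_next (nth m 0)

theorem splitWheel_connected {j : ℕ} (hj : j < m) : (splitWheel m hj).Connected :=
  wheel_connected _ _ _ _ sameCycle_next (nth m 0)

theorem rangeFactorization_faceClass_eq_iff {j : ℕ} (hj : j < m) (i i' : Rim m) :
    Set.rangeFactorization (faceClass m j) i = Set.rangeFactorization (faceClass m j) i' ↔
      (split m j).SameCycle i i' := by
  rw [← faceClass_iff hj, Subtype.ext_iff]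
  rfl

theorem splitWheel_isFaceMap {j : ℕ} (hj : j < m) :
    (splitWheel m hj).IsFaceMap (wheelFace (next m) (Set.rangeFactorization (faceClass m j))) := by
  exact wheel_isFaceMap _ _ _ _ sameCycle_next (nth m 0) _ Set.rangeFactorization_surjective
    (rangeFactorization_faceClass_eq_iff hj)

theorem wholeMap_isConnected : (wholeMap m k).IsConnected :=
  (wholeWheel_connected.subdivide _).isConnected

theorem splitMap_isConnected {j : ℕ} (hj : j < m) : (splitMap m k hj).IsConnected :=
  ((splitWheel_connected hj).subdivide _).isConnected

theorem wholeMap_isPlane : (wholeMap m k).IsPlane := by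
  refine wholeWheel_connected.isPlane_subdivide _ (F := wheelFace (next m) id)
    (wheel_isFaceMap _ _ _ _ sameCycle_next (nth m 0) _ Function.surjective_id
      fun i i' => Equiv.Perm.sameCycle_one.symm) ?_
  show Nat.card (Unit ⊕ Rim m) + Nat.card (Option (Rim m)) = Nat.card (Rim m ⊕ Rim m) + 2
  have := card_rim (m := m)
  simp only [Nat.card_sum, Finite.card_option, this, Nat.card_unique]
  omega

theorem splitMap_isPlane {j : ℕ} (hj : j < m) : (splitMap m k hj).IsPlane := by
  refine (splitWheel_connected hj).isPlane_subdivide _ (splitWheel_isFaceMap hj) ?_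
  show Nat.card (Bool ⊕ Rim m) + Nat.card (Option (Set.range (faceClass m j))) =
    Nat.card (Rim m ⊕ Rim m) + 2
  have h1 := card_rim (m := m)
  have h2 := card_range_faceClass hj
  simp only [Nat.card_sum, Finite.card_option, h1, Nat.card_eq_fintype_card (α := Bool),
    Fintype.card_bool]
  omega

/-- The identification of the two hubs. -/
def mergeHubs (m k : ℕ) (v : (Bool ⊕ Rim m) ⊕ (Σ e, Fin (newVerts m k e))) :
    (Unit ⊕ Rim m) ⊕ (Σ e, Fin (newVerts m k e)) :=
  Sum.map (Sum.map (fun _ => ()) id) id v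

omit [NeZero m] in
theorem mergeHubs_eq_iff (x y : (Bool ⊕ Rim m) ⊕ (Σ e, Fin (newVerts m k e))) :
    mergeHubs m k x = mergeHubs m k y ↔ x = y ∨
      (x = Sum.inl (Sum.inl true) ∧ y = Sum.inl (Sum.inl false)) ∨
      (x = Sum.inl (Sum.inl false) ∧ y = Sum.inl (Sum.inl true)) := by
  rcases x with (x | x) | x <;> rcases y with (y | y) | y <;> simp [mergeHubs]
  cases x <;> cases y <;> simp

theorem mergeHubs_vert {j : ℕ} (hj : j < m) (c : (splitMap m k hj).C) :
    (wholeMap m k).vert c = mergeHubs m k ((splitMap m k hj).vert c) := by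
  obtain ⟨x, s⟩ := c
  show (wholeWheel m).subdivideVert (newVerts m k) x =
    mergeHubs m k ((splitWheel m hj).subdivideVert (newVerts m k) x)
  induction x using dart_cases with
  | h x =>
    have h1 := subdivideVert_firstDart (wholeWheel m) (newVerts m k) x
    have h2 := congrArg (mergeHubs m k) (subdivideVert_firstDart (splitWheel m hj) (newVerts m k) x)
    refine h1.trans (Eq.trans ?_ h2.symm)
    obtain ⟨i | i, _ | _⟩ := x <;> rfl
  | h1 e q => rfl
  | h2 e q =>
    refine (subdivideVert_castSucc (wholeWheel m) _ e q).trans ?_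
    exact congrArg (mergeHubs m k)
      (subdivideVert_castSucc (splitWheel m hj) (newVerts m k) e q).symm

theorem subdivideRot_congr {E : Type} (m : E → ℕ) (σ τ : E × Bool → E × Bool)
    (x : (Σ e, Fin (m e + 1)) × Bool) (h : ∀ y, x = firstDart m y → σ y = τ y) :
    subdivideRot m σ x = subdivideRot m τ x := by
  induction x using dart_cases with
  | h x => rw [subdivideRot_firstDart, subdivideRot_firstDart, h x rfl]
  | h1 e q => rfl
  | h2 e q => simp

/-- The two hubs are merged at the spokes at positions `3 j` and `3 m - 1`, which are on a common
face. -/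
theorem vertexGluing_splitMap {j : ℕ} (hj : j < m) :
    CMap.VertexGluing (splitMap m k hj) (wholeMap m k) := by
  let α : Rim m := nth m (3 * j)
  let β : Rim m := nth m (3 * m - 1)
  let spoke : Rim m → (Σ e, Fin (newVerts m k e + 1)) × Bool := fun i =>
    firstDart (newVerts m k) (Sum.inl i, true)
  have hα : split m j α = β := Equiv.swap_apply_left _ _
  have hβ : split m j β = α := Equiv.swap_apply_right _ _
  have hα' : (split m j).symm α = β := by rw [Equiv.symm_apply_eq, hβ]
  have hβ' : (split m j).symm β = α := by rw [Equiv.symm_apply_eq, hα]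
  have hother : ∀ i, i ≠ α → i ≠ β → split m j i = i := fun i h1 h2 =>
    Equiv.swap_apply_of_ne_of_ne h1 h2
  have hvert : ∀ i, (splitMap m k hj).vert (spoke i, true) = Sum.inl (Sum.inl (hub j i)) := fun i =>
    subdivideVert_firstDart (splitWheel m hj) (newVerts m k) (Sum.inl i, true)
  have hsplit : ∀ i, (splitMap m k hj).a1 (spoke i, true) =
      (spoke (next m ((split m j).symm i)), false) := fun i =>
    congrArg (fun x => (x, false)) (subdivideRot_firstDart (newVerts m k)
      (wheelRot (next m) (split m j)).symm (Sum.inl i, true))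
  have hwhole : ∀ i, (wholeMap m k).a1 (spoke i, true) = (spoke (next m i), false) := fun i =>
    congrArg (fun x => (x, false)) (subdivideRot_firstDart (newVerts m k)
      (wheelRot (next m) 1).symm (Sum.inl i, true))
  refine ⟨Sum.inl (Sum.inl true), Sum.inl (Sum.inl false), mergeHubs m k, Equiv.refl _, ?_, ?_,
    mergeHubs_eq_iff k, mergeHubs_vert k hj, fun c => rfl, fun c => rfl,
    Or.inl ⟨(spoke α, true), (spoke β, true), ?_, ?_, Or.inl ?_, ?_, ?_, ?_⟩⟩
  · intro h
    cases Sum.inl.inj (Sum.inl.inj h)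
  · rintro ((v | v) | v)
    · exact ⟨Sum.inl (Sum.inl true), rfl⟩
    · exact ⟨Sum.inl (Sum.inr v), rfl⟩
    · exact ⟨Sum.inr v, rfl⟩
  · refine (hvert α).trans (congrArg (fun h => Sum.inl (Sum.inl h)) ?_)
    rw [hub, pos_nth (by omega)]
    simp
  · refine (hvert β).trans (congrArg (fun h => Sum.inl (Sum.inl h)) ?_)
    rw [hub, pos_nth (by omega), decide_eq_false]
    omega
  · refine ((splitWheel_isFaceMap hj).subdivide (newVerts m k)).faceCoincident ?_
    exact congrArg some ((rangeFactorization_faceClass_eq_iff hj α β).2 ⟨1, hα⟩)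
  · exact (hwhole α).trans ((hsplit β).trans (by rw [hβ'])).symm
  · exact (hwhole β).trans ((hsplit α).trans (by rw [hα'])).symm
  · rintro ⟨x, _ | _⟩ ha hb hα1 hβ1
    · refine congrArg (fun x => (x, true)) (subdivideRot_congr _ _ _ x ?_)
      rintro ⟨i | i, _ | _⟩ rfl
      · rfl
      · refine congrArg (fun i => (Sum.inl i, true))
          (hother _ (fun h => hβ1 ?_) fun h => hα1 ?_).symm
        · have h' : i = next m α := (Equiv.symm_apply_eq _).1 h
          refine Eq.trans ?_ (hsplit β).symm
          rw [hβ', h']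
          rfl
        · have h' : i = next m β := (Equiv.symm_apply_eq _).1 h
          refine Eq.trans ?_ (hsplit α).symm
          rw [hα', h']
          rfl
      · rfl
      · rfl
    · refine congrArg (fun x => (x, false)) (subdivideRot_congr _ _ _ x ?_)
      rintro ⟨i | i, _ | _⟩ rfl
      · rfl
      · have h : split m j i = i := hother i (fun h => ha (by rw [h]; rfl))
          fun h => hb (by rw [h]; rfl)
        exact congrArg (fun i => (Sum.inl (next m i), true)) ((Equiv.symm_apply_eq _).2 h.symm).symm
      · rfl
      · rfl

theorem exists_splitMap_vert_eq {j : ℕ} (hj : j < m) (v : (splitMap m k hj).V) :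
    ∃ c, (splitMap m k hj).vert c = v := by
  obtain ⟨x, hx⟩ := ((splitWheel m hj).subdivide (newVerts m k)).vert_surjective v
  exact ⟨(x, true), hx⟩

theorem exists_wholeMap_vert_eq (v : (wholeMap m k).V) : ∃ c, (wholeMap m k).vert c = v := by
  obtain ⟨x, hx⟩ := ((wholeWheel m).subdivide (newVerts m k)).vert_surjective v
  exact ⟨(x, true), hx⟩

theorem numCrosses_splitMap_hub {j : ℕ} (hj : j < m) (h : Bool) :
    (splitMap m k hj).numCrosses
      (Sum.inl (Sum.inl h) : (Bool ⊕ Rim m) ⊕ (Σ e, Fin (newVerts m k e))) =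
        2 * (hub (m := m) j ⁻¹' {h}).ncard := by
  refine (numCrosses_eq _ _).trans (congrArg _ ?_)
  exact (degree_subdivide_inl (splitWheel m hj) (newVerts m k) _).trans
    (degree_wheel_hub _ _ _ _ _ h)

/-- The degrees of the two hubs are `3 j + 1` and `3 (m - j) - 1`, and all other vertices have
degree at most three. -/
theorem numCrosses_splitMap_cases {j : ℕ} (hj : j < m) (v : (splitMap m k hj).V) :
    (splitMap m k hj).numCrosses v = 2 * (3 * j + 1) ∨
      (splitMap m k hj).numCrosses v + 2 * (3 * j + 1) = 6 * m ∨
        (splitMap m k hj).numCrosses v ≤ 6 := by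
  change (Bool ⊕ Rim m) ⊕ (Σ e, Fin (newVerts m k e)) at v
  rcases v with ((_ | _) | i) | q
  · have h1 := numCrosses_splitMap_hub k hj false
    have h2 := ncard_hub_false hj
    omega
  · have h1 := numCrosses_splitMap_hub k hj true
    have h2 := ncard_hub_true hj
    omega
  · have h1 := numCrosses_eq ((splitWheel m hj).subdivide (newVerts m k)) (Sum.inl (Sum.inr i))
    have h2 := degree_subdivide_inl (splitWheel m hj) (newVerts m k) (Sum.inr i)
    have h3 : (splitWheel m hj).degree (Sum.inr i) ≤ 3 := degree_wheel_rim_le _ _ _ _ _ i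
    refine Or.inr (Or.inr (h1.trans_le ?_))
    rw [show RotationSystem.degree _ _ = _ from h2]
    omega
  · have h1 := numCrosses_eq ((splitWheel m hj).subdivide (newVerts m k)) (Sum.inr q)
    have h2 := degree_subdivide_inr_le (splitWheel m hj) (newVerts m k) q
    exact Or.inr (Or.inr (h1.trans_le ((Nat.mul_le_mul_left 2 h2).trans (by norm_num))))

end

/-! ### The split wheels have no colourings -/

/-- Along consecutive blocks at the same hub, of colour `h`, the two rim vertices that are adjacent
to the hub receive the colours `h + 1` and `h - 1`, in an order that alternates from block to
block. -/
theorem blocks_alternate {N : ℕ} (h2 : (2 : ZMod N) ≠ 0) (h4 : (4 : ZMod N) ≠ 0) {h : ZMod N}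
    {b c d : ℕ → ZMod N} {a l : ℕ}
    (hc : ∀ t, a ≤ t → t < a + l → c t - h = 1 ∨ c t - h = -1)
    (hd : ∀ t, a ≤ t → t < a + l → d t - h = 1 ∨ d t - h = -1)
    (hcd : ∀ t, a ≤ t → t < a + l → d t - c t ≠ 0)
    (hb : ∀ t, a ≤ t → t + 1 < a + l → b (t + 1) - h ≠ 0)
    (hdb : ∀ t, a ≤ t → t + 1 < a + l → b (t + 1) - d t = 1 ∨ b (t + 1) - d t = -1)
    (hbc : ∀ t, a ≤ t → t + 1 < a + l → c (t + 1) - b (t + 1) = 1 ∨ c (t + 1) - b (t + 1) = -1)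
    (i : ℕ) (hi : i < l) :
    c (a + i) - h = (-1) ^ i * (c a - h) ∧ d (a + i) - h = -((-1) ^ i * (c a - h)) := by
  have hopp : ∀ t, a ≤ t → t < a + l → d t - h = -(c t - h) := by
    intro t h1 h2'
    have h3 := hcd t h1 h2'
    rcases hc t h1 h2' with h4' | h4' <;> rcases hd t h1 h2' with h5 | h5
    · exact absurd (by linear_combination h5 - h4') h3
    · rw [h4', h5]
    · rw [h4', h5, neg_neg]
    · exact absurd (by linear_combination h5 - h4') h3
  have hflip : ∀ t, a ≤ t → t + 1 < a + l → c (t + 1) - h = -(c t - h) := by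
    intro t h1 h2'
    have e1 := hopp t h1 (by omega)
    have e2 := hb t h1 h2'
    rcases hc t h1 (by omega) with e3 | e3 <;> rcases hdb t h1 h2' with e4 | e4 <;>
      rcases hbc t h1 h2' with e5 | e5 <;> rcases hc (t + 1) (by omega) h2' with e6 | e6 <;>
      first
        | exact absurd (by linear_combination e1 - e3 + e4) e2
        | (rw [e6, e3]; done)
        | (rw [e6, e3, neg_neg]; done)
        | exact absurd (by linear_combination e6 - e5 - e4 - e1 + e3) h2
        | exact absurd (by linear_combination -e6 + e5 + e4 + e1 - e3) h2
        | exact absurd (by linear_combination e6 - e5 - e4 - e1 + e3) h4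
        | exact absurd (by linear_combination -e6 + e5 + e4 + e1 - e3) h4
  have hci : ∀ i < l, c (a + i) - h = (-1) ^ i * (c a - h) := by
    intro i hi
    induction i with
    | zero => simp
    | succ i ih =>
      rw [← add_assoc, hflip (a + i) (by omega) (by omega), ih (by omega), pow_succ]
      ring
  exact ⟨hci i hi, by rw [hopp (a + i) (by omega) (by omega), hci i hi]⟩

theorem RotationSystem.IsWalkDiff.eq_one_or_neg_one {N l : ℕ} (hl : l = 0) {d : ZMod N}
    (h : IsWalkDiff N (l + 1) d) : d = 1 ∨ d = -1 := by
  subst hl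
  exact isWalkDiff_one.1 h

section

variable {m : ℕ} [NeZero m] {k : ℕ}

theorem natCast_ne_zero_of_le (hk : 3 ≤ k) {a : ℕ} (ha : a ≠ 0) (ha' : a ≤ 6) :
    (a : ZMod (2 * k + 1)) ≠ 0 := by
  rw [Ne, ZMod.natCast_eq_zero_iff]
  intro h
  have := Nat.le_of_dvd (by omega) h
  omega

/-- If `h₁` and `h₂` are the colours of the hubs, the first hub forces the two spokes at its ends to
lead to vertices of colours `h₁ + 2 s` and `h₁ - 2 s`, where `s` is a sign, while the second hub
forces the neighbours of these two vertices on the rim to have equal colours. -/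
theorem not_hasColoring_splitMap (hm : Odd m) (hk : 3 ≤ k) {j : ℕ} (hjo : Odd j) (hj : j < m) :
    ¬ (splitMap m k hj).HasColoring (2 * k + 1) Set.univ := by
  intro h
  obtain ⟨f, hf⟩ := (splitWheel m hj).exists_of_hasColoring_subdivide (newVerts m k) h
  change Bool ⊕ Rim m → ZMod (2 * k + 1) at f
  replace hf : ∀ e : Rim m ⊕ Rim m, IsWalkDiff (2 * k + 1) (newVerts m k e + 1)
    (f (wheelVert (next m) (hub j) (e, false)) - f (wheelVert (next m) (hub j) (e, true))) := hf
  have h2 : (2 : ZMod (2 * k + 1)) ≠ 0 := by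
    exact_mod_cast natCast_ne_zero_of_le hk (a := 2) (by norm_num) (by norm_num)
  have h4 : (4 : ZMod (2 * k + 1)) ≠ 0 := by
    exact_mod_cast natCast_ne_zero_of_le hk (a := 4) (by norm_num) (by norm_num)
  have h6 : (6 : ZMod (2 * k + 1)) ≠ 0 := by
    exact_mod_cast natCast_ne_zero_of_le hk (a := 6) (by norm_num) (by norm_num)
  let x : Fin 3 → ℕ → ZMod (2 * k + 1) := fun κ t => f (Sum.inr ((t : ZMod m), κ))
  have hub_low : ∀ (κ : Fin 3) (t : ℕ), 3 * t + κ ≤ 3 * j → hub j ((t : ZMod m), κ) = true := by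
    intro κ t ht
    refine decide_eq_true ?_
    show 3 * (t : ZMod m).val + κ ≤ 3 * j
    rwa [ZMod.val_cast_of_lt (by omega)]
  have hub_high : ∀ (κ : Fin 3) (t : ℕ), t < m → 3 * j < 3 * t + κ →
      hub j ((t : ZMod m), κ) = false := by
    intro κ t ht ht'
    refine decide_eq_false ?_
    show ¬ 3 * (t : ZMod m).val + κ ≤ 3 * j
    rw [ZMod.val_cast_of_lt ht]
    omega
  have hspoke : ∀ (κ : Fin 3) (t : ℕ), κ ≠ 0 →
      x κ t - f (Sum.inl (hub j ((t : ZMod m), κ))) = 1 ∨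
        x κ t - f (Sum.inl (hub j ((t : ZMod m), κ))) = -1 := fun κ t hκ =>
    IsWalkDiff.eq_one_or_neg_one (if_neg hκ) (hf (Sum.inl ((t : ZMod m), κ)))
  have hweak : ∀ t : ℕ, x 0 t - f (Sum.inl (hub j ((t : ZMod m), 0))) ≠ 0 := fun t =>
    (isWalkDiff_iff_ne_zero (by omega)).1 (hf (Sum.inl ((t : ZMod m), 0)))
  have h01 : ∀ t : ℕ, x 1 t - x 0 t = 1 ∨ x 1 t - x 0 t = -1 := fun t =>
    IsWalkDiff.eq_one_or_neg_one rfl (hf (Sum.inr ((t : ZMod m), 0)))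
  have h12 : ∀ t : ℕ, x 2 t - x 1 t ≠ 0 := fun t =>
    (isWalkDiff_iff_ne_zero (by omega)).1 (hf (Sum.inr ((t : ZMod m), 1)))
  have h20 : ∀ t : ℕ, x 0 (t + 1) - x 2 t = 1 ∨ x 0 (t + 1) - x 2 t = -1 := by
    intro t
    have := IsWalkDiff.eq_one_or_neg_one rfl (hf (Sum.inr ((t : ZMod m), 2)))
    simp only [x]
    rw [Nat.cast_succ]
    exact this
  have hxm : x 0 m = x 0 0 := by simp [x]
  set u := f (Sum.inl true) with hu
  set v := f (Sum.inl false) with hv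
  have hj0 : 0 < j := hjo.pos
  have low := blocks_alternate h2 h4 (h := u) (b := x 0) (c := x 1) (d := x 2) (a := 0) (l := j)
    (fun t _ ht => by
      have := hspoke 1 t (by decide)
      rwa [hub_low 1 t (by simp; omega)] at this)
    (fun t _ ht => by
      have := hspoke 2 t (by decide)
      rwa [hub_low 2 t (by simp; omega)] at this)
    (fun t _ _ => h12 t)
    (fun t _ ht => by
      have := hweak (t + 1)
      rwa [hub_low 0 (t + 1) (by simp; omega)] at this)
    (fun t _ _ => h20 t) (fun t _ _ => h01 (t + 1)) (j - 1) (by omega)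
  have high := blocks_alternate h2 h4 (h := v) (b := x 0) (c := x 1) (d := x 2) (a := j)
    (l := m - j)
    (fun t _ ht => by
      have := hspoke 1 t (by decide)
      rwa [hub_high 1 t (by omega) (by simp; omega)] at this)
    (fun t _ ht => by
      have := hspoke 2 t (by decide)
      rwa [hub_high 2 t (by omega) (by simp; omega)] at this)
    (fun t _ _ => h12 t)
    (fun t _ ht => by
      have := hweak (t + 1)
      rwa [hub_high 0 (t + 1) (by omega) (by simp; omega)] at this)
    (fun t _ _ => h20 t) (fun t _ _ => h01 (t + 1)) (m - j - 1) (by omega)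
  have e1 : x 2 (j - 1) - u = -(x 1 0 - u) := by
    have := low.2
    rwa [zero_add, Even.neg_one_pow (by obtain ⟨q, rfl⟩ := hjo; simp), one_mul] at this
  have e2 : x 2 (m - 1) = x 1 j := by
    have := high.2
    have hodd : Odd (m - j - 1) := by
      obtain ⟨q, rfl⟩ := hjo
      obtain ⟨p, rfl⟩ := hm
      exact ⟨p - q - 1, by omega⟩
    rw [Odd.neg_one_pow hodd, show j + (m - j - 1) = m - 1 by omega] at this
    linear_combination this
  have b0 := hweak 0
  rw [hub_low 0 0 (by simp)] at b0
  have bj := hweak j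
  rw [hub_low 0 j (by simp)] at bj
  have c0 := hspoke 1 0 (by decide)
  rw [hub_low 1 0 (by simp; omega)] at c0
  have r0 := h01 0
  have rj := h20 (j - 1)
  rw [Nat.sub_add_cancel hj0] at rj
  have rj' := h01 j
  have rm := h20 (m - 1)
  rw [Nat.sub_add_cancel (by omega), hxm, e2] at rm
  rw [← hu] at b0 bj c0
  have f0 : x 0 0 - u = 2 * (x 1 0 - u) := by
    rcases c0 with c0 | c0 <;> rcases r0 with r0 | r0
    · exact absurd (by linear_combination c0 - r0) b0
    · linear_combination -c0 - r0
    · linear_combination -c0 - r0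
    · exact absurd (by linear_combination c0 - r0) b0
  have fj : x 0 j - u = -2 * (x 1 0 - u) := by
    rcases c0 with c0 | c0 <;> rcases rj with rj | rj
    · exact absurd (by linear_combination e1 + rj - c0) bj
    · linear_combination e1 + rj + c0
    · linear_combination e1 + rj + c0
    · exact absurd (by linear_combination e1 + rj - c0) bj
  have key : 4 * (x 1 0 - u) = (x 1 j - x 0 j) + (x 0 0 - x 1 j) := by
    linear_combination fj - f0
  rcases c0 with c0 | c0 <;> rcases rj' with r | r <;> rcases rm with r' | r' <;>
    rw [c0, r, r'] at key <;>
    first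
      | exact h2 (by linear_combination key)
      | exact h2 (by linear_combination -key)
      | exact h4 (by linear_combination key)
      | exact h4 (by linear_combination -key)
      | exact h6 (by linear_combination key)
      | exact h6 (by linear_combination -key)

/-! ### Colourings of the whole wheel after the deletion of an edge -/

/-- Colours of the rim vertices if the hub has colour `0`.  They alternate from block to block,
except for the block `t₀`, where they are given by `w`; since the number of blocks is odd, the
pattern is interrupted at this block. -/
def rimColor {N : ℕ} (t₀ : ZMod m) (w : Fin 3 → ZMod N) (i : Rim m) : ZMod N :=
  if i.1 = t₀ then w i.2 else (-1) ^ (i.1 - t₀).val * (![2, 1, -1] : Fin 3 → ZMod N) i.2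

omit [NeZero m] in
theorem rimColor_of_eq {N : ℕ} (t₀ : ZMod m) (w : Fin 3 → ZMod N) (κ : Fin 3) :
    rimColor t₀ w (t₀, κ) = w κ := if_pos rfl

omit [NeZero m] in
theorem rimColor_of_ne {N : ℕ} {t t₀ : ZMod m} (h : t ≠ t₀) (w : Fin 3 → ZMod N) :
    ∃ ε : ZMod N, (ε = 1 ∨ ε = -1) ∧ ε = (-1) ^ (t - t₀).val ∧ rimColor t₀ w (t, 0) = 2 * ε ∧
      rimColor t₀ w (t, 1) = ε ∧ rimColor t₀ w (t, 2) = -ε := by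
  refine ⟨(-1) ^ (t - t₀).val, neg_one_pow_eq_or _ _, rfl, ?_, ?_, ?_⟩
  · rw [rimColor, if_neg h, mul_comm]
    rfl
  · rw [rimColor, if_neg h]
    simp
  · rw [rimColor, if_neg h]
    simp

/-- The colours of the block `t₀` are only required to be compatible with the edges in or just after
this block. -/
theorem isWalkDiff_rimColor (hm : Odd m) (hm3 : 3 ≤ m) (hk : 3 ≤ k) (t₀ : ZMod m)
    (w : Fin 3 → ZMod (2 * k + 1)) (e₀ : Rim m ⊕ Rim m) (hw : w 0 = 0 ∨ w 0 = -2)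
    (s0 : e₀ ≠ Sum.inl (t₀, 0) → w 0 ≠ 0)
    (s1 : e₀ ≠ Sum.inl (t₀, 1) → w 1 = 1 ∨ w 1 = -1)
    (s2 : e₀ ≠ Sum.inl (t₀, 2) → w 2 = 1 ∨ w 2 = -1)
    (r0 : e₀ ≠ Sum.inr (t₀, 0) → w 1 - w 0 = 1 ∨ w 1 - w 0 = -1)
    (r1 : e₀ ≠ Sum.inr (t₀, 1) → w 2 - w 1 ≠ 0)
    (r2 : e₀ ≠ Sum.inr (t₀, 2) → -2 - w 2 = 1 ∨ -2 - w 2 = -1)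
    (f : Unit ⊕ Rim m → ZMod (2 * k + 1)) (hf : f = Sum.elim (fun _ => 0) (rimColor t₀ w))
    (e : Rim m ⊕ Rim m) (he : e ≠ e₀) :
    IsWalkDiff (2 * k + 1) (newVerts m k e + 1)
      (f (wheelVert (next m) (fun _ => ()) (e, false)) -
        f (wheelVert (next m) (fun _ => ()) (e, true))) := by
  have h2 : (2 : ZMod (2 * k + 1)) ≠ 0 := by
    exact_mod_cast natCast_ne_zero_of_le hk (a := 2) (by norm_num) (by norm_num)
  have hval : ∀ t, t ≠ t₀ → t + 1 ≠ t₀ → (t + 1 - t₀).val = (t - t₀).val + 1 := by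
    intro t h1 h3
    have h4 : t + 1 - t₀ ≠ 0 := sub_ne_zero.2 h3
    rw [show t + 1 - t₀ = t - t₀ + 1 by ring] at h4 ⊢
    have hlt := ZMod.val_lt (t - t₀)
    rw [ZMod.val_add_of_lt, ZMod.val_one'' (by omega)]
    rw [ZMod.val_one'' (by omega)]
    refine lt_of_le_of_ne hlt fun h => h4 ?_
    rw [← ZMod.natCast_zmod_val (t - t₀), ← Nat.cast_one, ← Nat.cast_add,
      show (t - t₀).val + 1 = m from h, ZMod.natCast_self]
  subst hf
  have strong : ∀ {l : ℕ} {d : ZMod (2 * k + 1)}, l = 0 → (d = 1 ∨ d = -1) →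
      IsWalkDiff (2 * k + 1) (l + 1) d := by
    rintro l d rfl h
    exact isWalkDiff_one.2 h
  have weak : ∀ {d : ZMod (2 * k + 1)}, d ≠ 0 → IsWalkDiff (2 * k + 1) (2 * k - 2 + 1) d :=
    fun h => (isWalkDiff_iff_ne_zero (by omega)).2 h
  rcases e with ⟨t, κ⟩ | ⟨t, κ⟩
  · show IsWalkDiff (2 * k + 1) (newVerts m k (Sum.inl (t, κ)) + 1) (rimColor t₀ w (t, κ) - 0)
    rw [sub_zero]
    by_cases ht : t = t₀
    · subst ht
      rw [rimColor_of_eq]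
      fin_cases κ
      · exact weak (s0 he.symm)
      · exact strong rfl (s1 he.symm)
      · exact strong rfl (s2 he.symm)
    · obtain ⟨ε, hε, -, h0, h1, h2'⟩ := rimColor_of_ne ht w
      fin_cases κ
      · refine weak ?_
        show rimColor t₀ w (t, 0) ≠ 0
        rw [h0]
        rcases hε with rfl | rfl <;> simpa using h2
      · refine strong rfl ?_
        show rimColor t₀ w (t, 1) = 1 ∨ rimColor t₀ w (t, 1) = -1
        rwa [h1]
      · refine strong rfl ?_
        show rimColor t₀ w (t, 2) = 1 ∨ rimColor t₀ w (t, 2) = -1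
        rw [h2', neg_inj, neg_eq_iff_eq_neg]
        exact hε.symm
  · show IsWalkDiff (2 * k + 1) (newVerts m k (Sum.inr (t, κ)) + 1)
      (rimColor t₀ w (next m (t, κ)) - rimColor t₀ w (t, κ))
    by_cases ht : t = t₀
    · subst ht
      fin_cases κ
      · refine strong rfl ?_
        show rimColor t w (t, 1) - rimColor t w (t, 0) = 1 ∨
          rimColor t w (t, 1) - rimColor t w (t, 0) = -1
        rw [rimColor_of_eq, rimColor_of_eq]
        exact r0 he.symm
      · refine weak ?_
        show rimColor t w (t, 2) - rimColor t w (t, 1) ≠ 0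
        rw [rimColor_of_eq, rimColor_of_eq]
        exact r1 he.symm
      · refine strong rfl ?_
        show rimColor t w (t + 1, 0) - rimColor t w (t, 2) = 1 ∨
          rimColor t w (t + 1, 0) - rimColor t w (t, 2) = -1
        have hne : t + 1 ≠ t := by
          intro h
          have h' : ((1 : ℕ) : ZMod m) = 0 := by simpa using h
          rw [ZMod.natCast_eq_zero_iff] at h'
          have := Nat.le_of_dvd one_pos h'
          omega
        obtain ⟨ε, -, hε, h0, -⟩ := rimColor_of_ne hne w
        rw [add_sub_cancel_left, ZMod.val_one'' (by omega), pow_one] at hε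
        rw [h0, hε, rimColor_of_eq, mul_neg_one]
        exact r2 he.symm
    · obtain ⟨ε, hε, hε', h0, h1, h2'⟩ := rimColor_of_ne ht w
      fin_cases κ
      · refine strong rfl ?_
        show rimColor t₀ w (t, 1) - rimColor t₀ w (t, 0) = 1 ∨
          rimColor t₀ w (t, 1) - rimColor t₀ w (t, 0) = -1
        rw [h0, h1]
        rcases hε with rfl | rfl
        · right; ring
        · left; ring
      · refine weak ?_
        show rimColor t₀ w (t, 2) - rimColor t₀ w (t, 1) ≠ 0
        rw [h1, h2']
        rcases hε with rfl | rfl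
        · exact fun h => h2 (by linear_combination -h)
        · exact fun h => h2 (by linear_combination h)
      · refine strong rfl ?_
        show rimColor t₀ w (t + 1, 0) - rimColor t₀ w (t, 2) = 1 ∨
          rimColor t₀ w (t + 1, 0) - rimColor t₀ w (t, 2) = -1
        by_cases ht1 : t + 1 = t₀
        · have hlast : ε = 1 := by
            rw [hε', ← ht1, show t - (t + 1) = -1 by ring]
            obtain ⟨q, rfl⟩ := hm
            rw [ZMod.val_neg_one]
            exact Even.neg_one_pow (by simp)
          rw [ht1, h2', rimColor_of_eq, hlast]
          rcases hw with hw | hw <;> rw [hw]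
          · left; ring
          · right; ring
        · obtain ⟨ε', -, hε2, h0', -⟩ := rimColor_of_ne ht1 w
          rw [hval t ht ht1, pow_succ, ← hε'] at hε2
          rw [h0', h2', hε2]
          rcases hε with rfl | rfl
          · right; ring
          · left; ring

theorem exists_coloring_wheel_of_ne (hm : Odd m) (hm3 : 3 ≤ m) (hk : 3 ≤ k) (e₀ : Rim m ⊕ Rim m) :
    ∃ f : Unit ⊕ Rim m → ZMod (2 * k + 1), ∀ e, e ≠ e₀ →
      IsWalkDiff (2 * k + 1) (newVerts m k e + 1)
        (f (wheelVert (next m) (fun _ => ()) (e, false)) -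
          f (wheelVert (next m) (fun _ => ()) (e, true))) := by
  have h2 : (2 : ZMod (2 * k + 1)) ≠ 0 := by
    exact_mod_cast natCast_ne_zero_of_le hk (a := 2) (by norm_num) (by norm_num)
  -- It is enough to give the colours of the block that contains the deleted edge.
  suffices h : ∃ (t₀ : ZMod m) (b c d : ZMod (2 * k + 1)), (b = 0 ∨ b = -2) ∧
      (e₀ ≠ Sum.inl (t₀, 0) → b ≠ 0) ∧
      (e₀ ≠ Sum.inl (t₀, 1) → c = 1 ∨ c = -1) ∧
      (e₀ ≠ Sum.inl (t₀, 2) → d = 1 ∨ d = -1) ∧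
      (e₀ ≠ Sum.inr (t₀, 0) → c - b = 1 ∨ c - b = -1) ∧
      (e₀ ≠ Sum.inr (t₀, 1) → d - c ≠ 0) ∧
      (e₀ ≠ Sum.inr (t₀, 2) → -2 - d = 1 ∨ -2 - d = -1) by
    obtain ⟨t₀, b, c, d, hb, s0, s1, s2, r0, r1, r2⟩ := h
    exact ⟨_, fun e he => isWalkDiff_rimColor hm hm3 hk t₀ ![b, c, d] e₀ hb s0 s1 s2 r0 r1 r2 _
      rfl e he⟩
  have hn2 : (-2 : ZMod (2 * k + 1)) ≠ 0 := neg_ne_zero.2 h2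
  rcases e₀ with ⟨t, κ⟩ | ⟨t, κ⟩ <;> fin_cases κ
  · refine ⟨t, 0, 1, -1, Or.inl rfl, fun h => absurd rfl h, fun _ => Or.inl rfl,
      fun _ => Or.inr rfl, fun _ => Or.inl (by ring), fun _ h => hn2 (by linear_combination h),
      fun _ => Or.inr (by ring)⟩
  · refine ⟨t, -2, -3, -1, Or.inr rfl, fun _ => hn2, fun h => absurd rfl h,
      fun _ => Or.inr rfl, fun _ => Or.inr (by ring), fun _ h => h2 (by linear_combination h),
      fun _ => Or.inr (by ring)⟩
  · refine ⟨t, -2, -1, -3, Or.inr rfl, fun _ => hn2, fun _ => Or.inr rfl,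
      fun h => absurd rfl h, fun _ => Or.inl (by ring), fun _ h => hn2 (by linear_combination h),
      fun _ => Or.inl (by ring)⟩
  · refine ⟨t, -2, 1, -1, Or.inr rfl, fun _ => hn2, fun _ => Or.inl rfl,
      fun _ => Or.inr rfl, fun h => absurd rfl h, fun _ h => hn2 (by linear_combination h),
      fun _ => Or.inr (by ring)⟩
  · refine ⟨t, -2, -1, -1, Or.inr rfl, fun _ => hn2, fun _ => Or.inr rfl,
      fun _ => Or.inr rfl, fun _ => Or.inl (by ring), fun h => absurd rfl h,
      fun _ => Or.inr (by ring)⟩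
  · refine ⟨t, -2, -1, 1, Or.inr rfl, fun _ => hn2, fun _ => Or.inr rfl,
      fun _ => Or.inl rfl, fun _ => Or.inl (by ring), fun _ h => h2 (by linear_combination h),
      fun h => absurd rfl h⟩

theorem hasColoring_wholeMap_delete (hm : Odd m) (hm3 : 3 ≤ m) (hk : 3 ≤ k)
    (q₀ : Σ e, Fin (newVerts m k e + 1)) :
    (wholeMap m k).HasColoring (2 * k + 1)
      {c : ((Σ e, Fin (newVerts m k e + 1)) × Bool) × Bool | c.1.1 ≠ q₀} := by
  obtain ⟨e₀, i₀⟩ := q₀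
  obtain ⟨f, hf⟩ := exists_coloring_wheel_of_ne (k := k) hm hm3 hk e₀
  exact (wholeWheel m).hasColoring_subdivide_of_forall_ne (newVerts m k) f e₀ hf i₀

theorem isCritical_splitMap (hm : Odd m) (hk : 3 ≤ k) {j : ℕ} (hjo : Odd j) (hj : j < m) :
    (splitMap m k hj).IsCritical (2 * k + 1) where
  not_hasColoring := not_hasColoring_splitMap hm hk hjo hj
  hasColoring_delete c₀ := by
    have hm3 : 3 ≤ m := by
      obtain ⟨p, rfl⟩ := hm
      obtain ⟨q, rfl⟩ := hjo
      omega
    obtain ⟨f, hf⟩ := hasColoring_wholeMap_delete hm hm3 hk c₀.1.1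
    refine ⟨fun v => f (mergeHubs m k v), fun c hc => ?_⟩
    have h := hf c fun h => hc ((edge_eq_iff _ c c₀).2 h)
    have h1 := mergeHubs_vert k hj c
    have h2 := mergeHubs_vert k hj ((splitMap m k hj).a0 c)
    show f (mergeHubs m k ((splitMap m k hj).vert ((splitMap m k hj).a0 c))) -
        f (mergeHubs m k ((splitMap m k hj).vert c)) = 1 ∨
      f (mergeHubs m k ((splitMap m k hj).vert ((splitMap m k hj).a0 c))) -
        f (mergeHubs m k ((splitMap m k hj).vert c)) = -1
    rwa [← h1, ← h2]
  exists_vert_eq := exists_splitMap_vert_eq k hj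

theorem isCritical_wholeMap (hm : Odd m) (hm3 : 3 ≤ m) (hk : 3 ≤ k) :
    (wholeMap m k).IsCritical (2 * k + 1) where
  not_hasColoring h := not_hasColoring_splitMap hm hk odd_one (by omega)
    ((vertexGluing_splitMap k (by omega)).hasColoring h)
  hasColoring_delete c₀ :=
    (hasColoring_wholeMap_delete hm hm3 hk c₀.1.1).mono fun c hc h =>
      hc ((edge_eq_iff _ c c₀).2 h)
  exists_vert_eq := exists_wholeMap_vert_eq k

/-! ### Cycles of length `2 k + 1` -/

/-- A cycle given by its successive darts. -/
theorem RotationSystem.hasCycle (R : RotationSystem) {l : ℕ} (hl : 2 ≤ l) (x : ℕ → R.E × Bool)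
    (hx : ∀ p < l, ∀ q < l, R.vert (x p) = R.vert (x q) → p = q)
    (he : ∀ p < l, ∀ q < l, (x p).1 = (x q).1 → p = q)
    (hlink : ∀ p < l, R.vert (revDart _ (x p)) = R.vert (x (p + 1))) (hclosed : x l = x 0) :
    HasCycle R.toCMap.graph l := by
  have : NeZero l := ⟨by omega⟩
  refine ⟨by omega, fun i => R.vert (x i.val), fun i => R.toCMap.edge (x i.val, true),
    fun i i' h => ?_, fun i i' h => ?_, fun i => ⟨(x i.val, true), rfl, rfl, ?_⟩⟩
  · exact ZMod.val_injective l (hx _ (ZMod.val_lt i) _ (ZMod.val_lt i') h)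
  · exact ZMod.val_injective l
      (he _ (ZMod.val_lt i) _ (ZMod.val_lt i') ((R.edge_eq_iff _ _).1 h))
  · refine (hlink i.val (ZMod.val_lt i)).trans (congrArg R.vert ?_)
    rcases Nat.eq_or_lt_of_le (ZMod.val_lt i) with hi | hi
    · have : i + 1 = 0 := by
        rw [← ZMod.natCast_zmod_val i, ← Nat.cast_one, ← Nat.cast_add,
          show i.val + 1 = l from hi, ZMod.natCast_self]
      rw [this, ZMod.val_zero, ← hclosed, show i.val + 1 = l from hi]
    · rw [ZMod.val_add_of_lt (by rw [ZMod.val_one'' (by omega)]; exact hi),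
        ZMod.val_one'' (by omega)]

/-- The boundary of an inner face of a subdivided wheel, if the spokes of this face are not
subdivided and lead to the same hub. -/
theorem hasCycle_wheel {I H : Type} [Finite I] [Finite H] (s τ : Equiv.Perm I) (hub : I → H)
    (hsurj : Function.Surjective hub)
    (hhub : ∀ i j, hub i = hub j ↔ (spokeRot s τ).SameCycle i j) (n : I ⊕ I → ℕ) (i : I)
    (h1 : n (Sum.inl i) = 0) (h2 : n (Sum.inl (s i)) = 0) (h3 : hub i = hub (s i))
    (h4 : i ≠ s i) :
    HasCycle ((wheel s τ hub hsurj hhub).subdivide n).toCMap.graph (n (Sum.inr i) + 3) := by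
  set R := wheel s τ hub hsurj hhub
  set l := n (Sum.inr i) with hl
  let path : Fin (l + 1) → (Σ e, Fin (n e + 1)) × Bool := fun a => (⟨Sum.inr i, a⟩, true)
  -- From the hub along the spoke `i`, along the subdivided rim edge `i`, and back along the spoke
  -- `s i`.
  let x : ℕ → (Σ e, Fin (n e + 1)) × Bool := fun p =>
    if p = 0 ∨ p = l + 3 then firstDart n (Sum.inl i, true)
    else if h : p - 1 < l + 1 then path ⟨p - 1, h⟩
    else firstDart n (Sum.inl (s i), false)
  have hx0 : x 0 = firstDart n (Sum.inl i, true) := if_pos (Or.inl rfl)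
  have hxl : x (l + 3) = firstDart n (Sum.inl i, true) := if_pos (Or.inr rfl)
  have hxp : ∀ (p : ℕ) (h : p < l + 1), x (p + 1) = path ⟨p, h⟩ := fun p h =>
    (if_neg (by omega)).trans (dif_pos (by omega))
  have hx2 : x (l + 2) = firstDart n (Sum.inl (s i), false) :=
    (if_neg (by omega)).trans (dif_neg (by omega))
  have hcases : ∀ p < l + 3, p = 0 ∨ (∃ a : Fin (l + 1), p = a + 1) ∨ p = l + 2 := by
    intro p hp
    by_cases h0 : p = 0
    · exact Or.inl h0
    · by_cases h1 : p = l + 2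
      · exact Or.inr (Or.inr h1)
      · exact Or.inr (Or.inl ⟨⟨p - 1, by omega⟩, by simp; omega⟩)
  have hrev : ∀ e d, n e = 0 → revDart _ (firstDart n (e, d)) = firstDart n (e, !d) := by
    intro e d he
    have h : ∀ a b : Fin (n e + 1), a = b := fun a b => Fin.ext (by omega)
    exact congrArg (fun a => ((⟨e, a⟩ : Σ e, Fin (n e + 1)), !d)) (h _ _)
  have hfirst : ∀ y, R.subdivideVert n (firstDart n y) = Sum.inl (wheelVert s hub y) := fun y =>
    R.subdivideVert_firstDart n y
  have hv0 : R.subdivideVert n (x 0) = Sum.inl (Sum.inl (hub i)) := by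
    rw [hx0]
    exact hfirst _
  have hv2 : R.subdivideVert n (x (l + 2)) = Sum.inl (Sum.inr (s i)) := by
    rw [hx2]
    exact hfirst _
  have hvz : R.subdivideVert n (path 0) = Sum.inl (Sum.inr i) := rfl
  have hvs : ∀ q : Fin l, R.subdivideVert n (path q.succ) = Sum.inr ⟨Sum.inr i, q⟩ := fun q => rfl
  have hxa : ∀ a : Fin (l + 1), x (a + 1) = path a := fun a => hxp a a.2
  have hpath : ∀ a v, R.subdivideVert n (path a) = Sum.inl v → v = Sum.inr i := by
    intro a v h
    induction a using Fin.cases with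
    | zero => exact (Sum.inl.inj (hvz.symm.trans h)).symm
    | succ q => cases (hvs q).symm.trans h
  have hpath_inj : ∀ a b, R.subdivideVert n (path a) = R.subdivideVert n (path b) → a = b := by
    intro a b h
    induction a using Fin.cases with
    | zero =>
      induction b using Fin.cases with
      | zero => rfl
      | succ q => cases h
    | succ q =>
      induction b using Fin.cases with
      | zero => cases h
      | succ q' =>
        have h' : (⟨Sum.inr i, q⟩ : Σ e, Fin (n e)) = ⟨Sum.inr i, q'⟩ := Sum.inr.inj h
        rw [eq_of_heq (Sigma.mk.inj h').2]
  refine ((wheel s τ hub hsurj hhub).subdivide n).hasCycle (by omega) x ?_ ?_ ?_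
    (hxl.trans hx0.symm)
  · show ∀ p < l + 3, ∀ q < l + 3, R.subdivideVert n (x p) = R.subdivideVert n (x q) → p = q
    intro p hp q hq h
    rcases hcases p hp with rfl | ⟨a, rfl⟩ | rfl <;> rcases hcases q hq with rfl | ⟨b, rfl⟩ | rfl
    · rfl
    · rw [hxa] at h
      cases hpath b _ (h.symm.trans hv0)
    · cases hv0.symm.trans (h.trans hv2)
    · rw [hxa] at h
      cases hpath a _ (h.trans hv0)
    · rw [hxa, hxa] at h
      rw [hpath_inj a b h]
    · rw [hxa] at h
      exact absurd (Sum.inr.inj (hpath a _ (h.trans hv2))).symm h4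
    · cases hv2.symm.trans (h.trans hv0)
    · rw [hxa] at h
      exact absurd (Sum.inr.inj (hpath b _ (h.symm.trans hv2))).symm h4
    · rfl
  · show ∀ p < l + 3, ∀ q < l + 3, (x p).1 = (x q).1 → p = q
    intro p hp q hq h
    rcases hcases p hp with rfl | ⟨a, rfl⟩ | rfl <;> rcases hcases q hq with rfl | ⟨b, rfl⟩ | rfl
    · rfl
    · rw [hx0, hxa] at h
      cases congrArg Sigma.fst h
    · rw [hx0, hx2] at h
      exact absurd (Sum.inl.inj (congrArg Sigma.fst h)) h4
    · rw [hx0, hxa] at h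
      cases congrArg Sigma.fst h
    · rw [hxa, hxa] at h
      rw [eq_of_heq (Sigma.mk.inj h).2]
    · rw [hx2, hxa] at h
      cases congrArg Sigma.fst h
    · rw [hx0, hx2] at h
      exact absurd (Sum.inl.inj (congrArg Sigma.fst h)).symm h4
    · rw [hx2, hxa] at h
      cases congrArg Sigma.fst h
    · rfl
  · show ∀ p < l + 3, R.subdivideVert n (revDart _ (x p)) = R.subdivideVert n (x (p + 1))
    intro p hp
    rcases hcases p hp with rfl | ⟨a, rfl⟩ | rfl
    · rw [hx0, hxp 0 (by omega)]
      exact (congrArg (R.subdivideVert n) (hrev _ _ h1)).trans (hfirst _)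
    · rw [hxa]
      induction a using Fin.lastCases with
      | last =>
        refine Eq.trans ?_ hv2.symm
        exact hfirst (Sum.inr i, false)
      | cast q =>
        refine (R.subdivideVert_castSucc n _ q).trans ?_
        rw [show ((q.castSucc : Fin (l + 1)) : ℕ) + 1 = (q.succ : Fin (l + 1)) from rfl, hxa]
        exact (hvs q).symm
    · rw [hx2, hxl]
      refine (congrArg (R.subdivideVert n) (hrev _ _ h2)).trans ?_
      refine (hfirst _).trans ((congrArg _ ?_).trans (hfirst _).symm)
      exact congrArg Sum.inl h3.symm

/-- The cycle bounds the inner face at the weak rim edge of block `0`. -/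
theorem hasCycle_wholeMap (hk : 1 ≤ k) : HasCycle (wholeMap m k).graph (2 * k + 1) := by
  have h := hasCycle_wheel (next m) 1 (fun _ => ()) (fun _ => ⟨nth m 0, rfl⟩) hub_unit
    (newVerts m k) (0, 1) rfl rfl rfl (by simp)
  have hl : newVerts m k (Sum.inr (0, 1)) + 3 = 2 * k + 1 := by
    show 2 * k - 2 + 3 = _
    omega
  exact hl ▸ h

/-- The same cycle as in the whole wheel: the spokes that it contains belong to block `0`, so they
stay at a common hub. -/
theorem hasCycle_splitMap (hk : 1 ≤ k) {j : ℕ} (hj : j < m) (hj0 : 0 < j) :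
    HasCycle (splitMap m k hj).graph (2 * k + 1) := by
  have hhub : hub j ((0, 1) : Rim m) = hub j (next m (0, 1)) := by
    have h1 : pos ((0, 1) : Rim m) = 1 := by simp [pos]
    have h2 : pos ((0, 2) : Rim m) = 2 := by simp [pos]
    rw [next_one]
    simp only [hub, decide_eq_decide, h1, h2]
    omega
  have h := hasCycle_wheel (next m) (split m j) (hub j) (hub_surjective hj) (hub_iff hj)
    (newVerts m k) (0, 1) rfl rfl hhub (by simp)
  have hl : newVerts m k (Sum.inr (0, 1)) + 3 = 2 * k + 1 := by
    show 2 * k - 2 + 3 = _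
    omega
  exact hl ▸ h

end

/-! ### The antichain -/

/-- The degree `3 i + 1` exceeds `3` and is congruent to `1` modulo `3`, unlike the degree
`3 m - 3 j - 1` of the second hub of the other map, so it occurs there only if `i = j`. -/
theorem not_hom_splitMap {m : ℕ} [NeZero m] {k : ℕ} (hm : Odd m) (hk : 3 ≤ k) {i j : ℕ}
    (hio : Odd i) (hi : i < m) (hjo : Odd j) (hj : j < m) (hij : i ≠ j) :
    ¬ CMap.Hom (splitMap m k hi) (splitMap m k hj) := by
  intro h
  obtain ⟨v, hv⟩ := (isCritical_splitMap hm hk hio hi).exists_numCrosses_eq_of_hom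
    (isCritical_splitMap hm hk hjo hj) rfl rfl h
    (Sum.inl (Sum.inl true) : (Bool ⊕ Rim m) ⊕ (Σ e, Fin (newVerts m k e)))
  rw [numCrosses_splitMap_hub, ncard_hub_true hi] at hv
  have := numCrosses_splitMap_cases k hj v
  have := hio.pos
  omega

theorem mainTheorem4 (n k : ℕ) (hn : Even n) (hk : Odd k) (hk3 : 3 ≤ k) :
    ∃ (B : CMap) (A : Fin n → CMap),
      (B.IsConnected ∧ B.IsPlane) ∧
      (∀ i, (A i).IsConnected ∧ (A i).IsPlane) ∧
      (∀ i, IsGraphCore (A i).graph) ∧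
      (∀ i, (A i).IsCore) ∧
      B.IsCore ∧
      HasOddGirth B.graph (2 * k + 1) ∧
      (∀ i, HasOddGirth (A i).graph (2 * k + 1)) ∧
      (∀ i, CMap.Hom (A i) B) ∧
      (∀ i, CMap.Epi (A i) B) ∧
      (∀ i j, i ≠ j → ¬ CMap.Hom (A i) (A j)) := by
  -- There are `2 n + 3` blocks, and the odd numbers `2 i + 1` with `i < n` are the places where the
  -- hub is split.
  have : NeZero (2 * n + 3) := ⟨by omega⟩
  have hm : Odd (2 * n + 3) := ⟨n + 1, by omega⟩
  have hlt : ∀ i : Fin n, 2 * (i : ℕ) + 1 < 2 * n + 3 := fun i => by omega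
  have hodd : ∀ i : Fin n, Odd (2 * (i : ℕ) + 1) := fun i => odd_two_mul_add_one _
  have hB := isCritical_wholeMap hm (by omega) hk3
  have hA := fun i => isCritical_splitMap hm hk3 (hodd i) (hlt i)
  have hgenus : ∀ i, (splitMap (2 * n + 3) k (hlt i)).signedGenus =
      (wholeMap (2 * n + 3) k).signedGenus := fun i =>
    (splitMap_isPlane k (hlt i)).trans (wholeMap_isPlane k).symm
  refine ⟨wholeMap (2 * n + 3) k, fun i => splitMap (2 * n + 3) k (hlt i),
    ⟨wholeMap_isConnected k, wholeMap_isPlane k⟩,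
    fun i => ⟨splitMap_isConnected k _, splitMap_isPlane k _⟩,
    fun i => (hA i).isGraphCore, fun i => (hA i).isCore, hB.isCore,
    hB.hasOddGirth (odd_two_mul_add_one k) (hasCycle_wholeMap (by omega)),
    fun i => (hA i).hasOddGirth (odd_two_mul_add_one k)
      (hasCycle_splitMap (by omega) _ (by omega)),
    fun i => (vertexGluing_splitMap k (hlt i)).hom (hgenus i),
    fun i => (vertexGluing_splitMap k (hlt i)).epi (hgenus i), fun i j hij => ?_⟩
  refine not_hom_splitMap hm hk3 (hodd i) (hlt i) (hodd j) (hlt j) fun h => hij (Fin.ext ?_)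
  omega
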